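/- Let $$P_3=1-x+\frac{x^3}{7},\qquad Q_3=\Bigl(1-\frac{3x^2}{7}\Bigr)\Bigl(1-x+\frac{2x^2}{7}\Bigr)\Bigl(1-\frac{5x}{4}+\frac{11x^2}{28}\Bigr),$$ $$\Psi_3=\frac{x^3(3x^2-7)^3(2x^2-7x+7)^3(11x^2-35x+28)^3}{1728\,(x^3-7x+7)^7},\qquad S=\sqrt{7-\tfrac{21}{4}x^2+x^4},$$ $$Y_0=\sqrt{1-\tfrac{2x}{3}},\qquad Y_1=\Bigl(\frac{21-8x^2+8S}{21+8\sqrt7}\Bigr)^{1/4},\qquad Y_2=\Bigl(\frac{21-8x^2-8S}{21-8\sqrt7}\Bigr)^{1/4},$$ $$W_1=\frac{2x^2-3x+2S}{2\sqrt7},\qquad W_2=\frac{3x-2x^2+2S}{2\sqrt7},$$ where $x$ is a complex variable near $0$ and all radicals are taken with principal branches (so $S=\sqrt7$, $Y_i=1$ and $W_i=1$ at $x=0$). Then for all complex $x$ in a neighborhood of $0$ the hypergeometric series below converge and $$\sqrt{P_3}\;{}_3F_2\!\left({-\frac1{14},\frac3{14},\frac5{14}\atop \frac13,\frac23}\,\Big|\,\Psi_3\right)=\frac{3+\sqrt7}{6}\,W_1Y_1+\frac{3-\sqrt7}{6}\,W_2Y_2,$$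 $$x\,Q_3P_3^{-11/6}\;{}_3F_2\!\left({\frac{11}{42},\frac{23}{42},\frac{29}{42}\atop \frac23,\frac43}\,\Big|\,\Psi_3\right)=\frac12\,xY_0-\frac{\sqrt7}{6}\,W_1Y_1+\frac{\sqrt7}{6}\,W_2Y_2,$$ $$x^2Q_3^2P_3^{-25/6}\;{}_3F_2\!\left({\frac{25}{42},\frac{37}{42},\frac{43}{42}\atop \frac43,\frac53}\,\Big|\,\Psi_3\right)=6\,xY_0+2\sqrt7\,W_1Y_1-2\sqrt7\,W_2Y_2.$$ Moreover, near $x=0$ the functions $xY_0,\ W_1Y_1,\ W_2Y_2$ form a basis of solutions of the third order linear differential equation for $Y(x)$ obtained from the hypergeometric equation $$\Bigl(z\tfrac{d}{dz}-\tfrac1{14}\Bigr)\Bigl(z\tfrac{d}{dz}+\tfrac3{14}\Bigr)\Bigl(z\tfrac{d}{dz}+\tfrac5{14}\Bigr)y=\tfrac{d}{dz}\Bigl(z\tfrac{d}{dz}-\tfrac23\Bigr)\Bigl(z\tfrac{d}{dz}-\tfrac13\Bigr)y$$ by the pull-back $z=\Psi_3(x)$, $Y(x)=\sqrt{P_3(x)}\;y(\Psi_3(x))$: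 there is $r>0$ such that for every non-empty connected open set $U\subseteq\{|x|<r\}$ these three functions are linearly independent on $U$ and the holomorphic solutions on $U$ are exactly their $\mathbb{C}$-linear combinations. (A holomorphic function on $U$ is called a solution if it satisfies the pulled-back equation at the points of $U$ where $\Psi_3'\neq0$ and $P_3\neq0$.) -/

import Mathlib

open Filter Topology

noncomputable section

namespace Darboux3B

/-- Coefficient of `z ^ n` in the generalized hypergeometric series `₃F₂(a₁,a₂,a₃; b₁,b₂; z)`:
`(a₁)ₙ (a₂)ₙ (a₃)ₙ / ((b₁)ₙ (b₂)ₙ n!)` with rising Pochhammer symbols. -/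
def hyp32Coeff (a₁ a₂ a₃ b₁ b₂ : ℂ) (n : ℕ) : ℂ :=
  ((ascPochhammer ℂ n).eval a₁ * (ascPochhammer ℂ n).eval a₂ * (ascPochhammer ℂ n).eval a₃) /
    ((ascPochhammer ℂ n).eval b₁ * (ascPochhammer ℂ n).eval b₂ * (n.factorial : ℂ))

/-- The generalized hypergeometric function `₃F₂(a₁,a₂,a₃; b₁,b₂; z)` as the sum of its series. -/
def hyp32 (a₁ a₂ a₃ b₁ b₂ z : ℂ) : ℂ :=
  ∑' n : ℕ, hyp32Coeff a₁ a₂ a₃ b₁ b₂ n * z ^ n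

/-- The derivation `d/dz` written in the variable `x`, where `z = φ x`,
namely `(1 / φ'(x)) d/dx`. -/
def pullDeriv (φ f : ℂ → ℂ) : ℂ → ℂ := fun x => deriv f x / deriv φ x

/-- The operator `z d/dz + a` written in the variable `x`, where `z = φ x`. -/
def pullEuler (φ : ℂ → ℂ) (a : ℂ) (f : ℂ → ℂ) : ℂ → ℂ :=
  fun x => φ x * pullDeriv φ f x + a * f x

/-- The hypergeometric differential equation
`(z d/dz + a₁)(z d/dz + a₂)(z d/dz + a₃) y = d/dz (z d/dz + b₁ - 1)(z d/dz + b₂ - 1) y`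
after the substitution `z = φ x`, at the point `x`, for the function `u x = y (φ x)`.
For `φ = id` this is the hypergeometric equation itself. -/
def HypEqAt (a₁ a₂ a₃ b₁ b₂ : ℂ) (φ u : ℂ → ℂ) (x : ℂ) : Prop :=
  pullEuler φ a₁ (pullEuler φ a₂ (pullEuler φ a₃ u)) x =
    pullDeriv φ (pullEuler φ (b₁ - 1) (pullEuler φ (b₂ - 1) u)) x

/-- `Y` is a holomorphic solution on `U` of the pull-back, under
`z ↦ φ x`, `y(z) ↦ Y(x) = θ x * y (φ x)`, of the hypergeometric equation with parameters
`a₁, a₂, a₃; b₁, b₂`.  The substitution makes sense wherever `φ' ≠ 0` and `θ ≠ 0`, and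
there the equation is imposed on `Y / θ`. -/
def IsPullbackSolutionOn (a₁ a₂ a₃ b₁ b₂ : ℂ) (θ φ : ℂ → ℂ) (U : Set ℂ) (Y : ℂ → ℂ) : Prop :=
  DifferentiableOn ℂ Y U ∧
    ∀ x ∈ U, deriv φ x ≠ 0 → θ x ≠ 0 →
      HypEqAt a₁ a₂ a₃ b₁ b₂ φ (fun t => Y t / θ t) x

/-- `B` is, near `x = 0`, a basis of solutions of the pulled-back hypergeometric equation:
on every non-empty connected open subset `U` of some disk around `0`, the holomorphic solutions
on `U` are exactly the linear combinations of the functions `B i`,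
and these are linearly independent on `U`. -/
def IsPullbackSolutionBasisNearZero (a₁ a₂ a₃ b₁ b₂ : ℂ) (θ φ : ℂ → ℂ)
    (B : Fin 3 → ℂ → ℂ) : Prop :=
  ∃ r : ℝ, 0 < r ∧ ∀ U : Set ℂ, IsOpen U → IsConnected U → U ⊆ Metric.ball 0 r →
    (∀ Y : ℂ → ℂ, IsPullbackSolutionOn a₁ a₂ a₃ b₁ b₂ θ φ U Y ↔
      ∃ c : Fin 3 → ℂ, ∀ x ∈ U, Y x = ∑ i, c i * B i x) ∧
    (∀ c : Fin 3 → ℂ, (∀ x ∈ U, ∑ i, c i * B i x = 0) → c = 0)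

/-- The positive square root of `7`. -/
def s7 : ℂ := ((Real.sqrt 7 : ℝ) : ℂ)

/-- The covering `Ψ₃` of degree 21. -/
def Psi3 (x : ℂ) : ℂ :=
  (x ^ 3 * (3 * x ^ 2 - 7) ^ 3 * (2 * x ^ 2 - 7 * x + 7) ^ 3 * (11 * x ^ 2 - 35 * x + 28) ^ 3) /
    (1728 * (x ^ 3 - 7 * x + 7) ^ 7)

def P3 (x : ℂ) : ℂ := 1 - x + x ^ 3 / 7

def Q3 (x : ℂ) : ℂ :=
  (1 - 3 * x ^ 2 / 7) * (1 - x + 2 * x ^ 2 / 7) * (1 - 5 * x / 4 + 11 * x ^ 2 / 28)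

/-- `√(7 - 21 x² / 4 + x⁴)`, the branch with value `√7` at `x = 0`
(all radicals below are principal values as well). -/
def S (x : ℂ) : ℂ := (7 - 21 / 4 * x ^ 2 + x ^ 4) ^ (1 / 2 : ℂ)

def Y0 (x : ℂ) : ℂ := (1 - 2 * x / 3) ^ (1 / 2 : ℂ)

def Y1 (x : ℂ) : ℂ := ((21 - 8 * x ^ 2 + 8 * S x) / (21 + 8 * s7)) ^ (1 / 4 : ℂ)

def Y2 (x : ℂ) : ℂ := ((21 - 8 * x ^ 2 - 8 * S x) / (21 - 8 * s7)) ^ (1 / 4 : ℂ)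

def W1 (x : ℂ) : ℂ := (2 * x ^ 2 - 3 * x + 2 * S x) / (2 * s7)

def W2 (x : ℂ) : ℂ := (3 * x - 2 * x ^ 2 + 2 * S x) / (2 * s7)

end Darboux3B

end

namespace Darboux3B

/-! Over z = 0 the covering Ψ₃ has order 3 at x = 0 and at the roots of A; over ∞ it has order 7 at
the roots of P; over 1 it has order 2 at the roots of R and is otherwise described by the factors T
(degree 1) and B (degree 4), with 2·8 + 1 + 4 = 21. The hypergeometric equation has exponents 0,
1/3, 2/3 at z = 0 and 0, 1/2, 1 at z = 1. Hence the pull-back has exponents 0, 1, 2 at x = 0 and at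
the roots of A and R, where its singularities disappear. What remains, for u = Y/√P₃, is an equation
with polynomial coefficients and leading coefficient P³TB (`hypEqAt_iff_ode`).

The radicals solve it for an elementary reason. Y₀/√P₃ has a rational logarithmic derivative, and
Y₁/√P₃, Y₂/√P₃ have logarithmic derivatives in ℂ(x, S). All derivatives of the three functions
therefore keep one shape, a numerator over a power of a fixed polynomial times a fixed function, and
the equation becomes a few polynomial identities (`linNum_ode`, `radNumA_ode`, `radNumB_ode`). The
last two functions are conjugate under S ↦ -S, so one computation serves both.

On the other side, z^e times a ₃F₂ with shifted parameters solves the hypergeometric equation for e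
= 0, 1/3, 2/3 (`hypEqAt_mul_hyp32`). The holomorphic function x Q₃ P₃^(-7/3) replaces the cube root
of Ψ₃.

The Wronskian of the algebraic solutions is 1/√7 at 0, hence nonzero on a small disk. By Abel's
identity and Cramer's rule every solution there is a combination of the three, fixed by its 2-jet at
0. Since Ψ₃ vanishes to order 3, the series do not affect these 2-jets, and each identity reduces to
a 3 × 3 linear system. The original form of the equation is meaningless at x = 0, where Ψ₃' = 0;
holomorphy bridges that point. -/

/-! ### Calculus of the pulled-back Euler operator -/

/-- On `V`, the function `v` is the image of `u` under `z d/dz` written in the variable `x`,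
`z = φ x`. -/
def IsEulerOn (φ : ℂ → ℂ) (V : Set ℂ) (u v : ℂ → ℂ) : Prop :=
  ∀ x ∈ V, DifferentiableAt ℂ u x ∧ φ x * (deriv u x / deriv φ x) = v x

theorem IsEulerOn.add_const_mul {φ : ℂ → ℂ} {V : Set ℂ} {u v u' v' : ℂ → ℂ}
    (h : IsEulerOn φ V u v) (h' : IsEulerOn φ V u' v') (a : ℂ) :
    IsEulerOn φ V (fun x => u x + a * u' x) (fun x => v x + a * v' x) := by
  intro x hx
  obtain ⟨h1, h2⟩ := h x hx
  obtain ⟨h3, h4⟩ := h' x hx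
  refine ⟨h1.add (h3.const_mul a), ?_⟩
  have := (h1.hasDerivAt.add (h3.hasDerivAt.const_mul a)).deriv
  have e : deriv (fun x => u x + a * u' x) x = deriv u x + a * deriv u' x := this
  simp only [e, ← h2, ← h4]
  ring

theorem IsEulerOn.congr {φ : ℂ → ℂ} {V : Set ℂ} (hV : IsOpen V) {u v w : ℂ → ℂ}
    (h : IsEulerOn φ V u v) (hw : ∀ x ∈ V, w x = u x) : IsEulerOn φ V w v := by
  intro x hx
  have : w =ᶠ[𝓝 x] u := by
    filter_upwards [hV.mem_nhds hx] with y hy using hw y hy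
  obtain ⟨h1, h2⟩ := h x hx
  exact ⟨h1.congr_of_eventuallyEq this, by rw [this.deriv_eq, h2]⟩

theorem IsEulerOn.pullEuler_eq {φ : ℂ → ℂ} {V : Set ℂ} {u v : ℂ → ℂ}
    (h : IsEulerOn φ V u v) (a : ℂ) : ∀ x ∈ V, pullEuler φ a u x = v x + a * u x := by
  intro x hx
  simp only [pullEuler, pullDeriv, (h x hx).2]

/-- Both sides become polynomials with constant coefficients in the Euler operator once the equation
is multiplied by z. The open set is needed because nested operators differentiate functions known
only through their values on it. -/
theorem hypEqAt_iff_of_isEulerOn {a₁ a₂ a₃ b₁ b₂ : ℂ} {φ : ℂ → ℂ} {V : Set ℂ} (hV : IsOpen V)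
    {u v₁ v₂ v₃ : ℂ → ℂ} (h₁ : IsEulerOn φ V u v₁) (h₂ : IsEulerOn φ V v₁ v₂)
    (h₃ : IsEulerOn φ V v₂ v₃) {x : ℂ} (hx : x ∈ V) (hφ : φ x ≠ 0) :
    HypEqAt a₁ a₂ a₃ b₁ b₂ φ u x ↔
      φ x * (v₃ x + (a₁ + a₂ + a₃) * v₂ x + (a₁ * a₂ + a₁ * a₃ + a₂ * a₃) * v₁ x
        + a₁ * a₂ * a₃ * u x) =
      v₃ x + ((b₁ - 1) + (b₂ - 1)) * v₂ x + (b₁ - 1) * (b₂ - 1) * v₁ x := by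
  have step : ∀ a : ℂ, IsEulerOn φ V (pullEuler φ a u) (fun x => v₂ x + a * v₁ x) := fun a =>
    (h₂.add_const_mul h₁ a).congr hV (h₁.pullEuler_eq a)
  have step2 : ∀ a b : ℂ, IsEulerOn φ V (pullEuler φ b (pullEuler φ a u))
      (fun x => (v₃ x + a * v₂ x) + b * (v₂ x + a * v₁ x)) := fun a b =>
    ((h₃.add_const_mul h₂ a).add_const_mul (h₂.add_const_mul h₁ a) b).congr hV (fun y hy => by
      rw [(step a).pullEuler_eq b y hy, h₁.pullEuler_eq a y hy])
  have hL := (step2 a₃ a₂).pullEuler_eq a₁ x hx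
  rw [(step a₃).pullEuler_eq a₂ x hx, h₁.pullEuler_eq a₃ x hx] at hL
  have hR := (step2 (b₂ - 1) (b₁ - 1) x hx).2
  unfold HypEqAt
  -- Multiplying by φ x ≠ 0 turns the outer d/dz on the right into z d/dz.
  rw [hL, pullDeriv, ← mul_right_inj' hφ, hR]
  constructor <;> intro h <;> linear_combination h

/-- Multiplication by a local exponent factor shifts the Euler operator. -/
theorem isEulerOn_mul_comp {φ g F G : ℂ → ℂ} {e : ℂ} {V : Set ℂ}
    (hφ : ∀ x ∈ V, DifferentiableAt ℂ φ x) (hφ' : ∀ x ∈ V, deriv φ x ≠ 0)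
    (hg : IsEulerOn φ V g (fun x => e * g x))
    (hF : ∀ x ∈ V, DifferentiableAt ℂ F (φ x))
    (hG : ∀ x ∈ V, φ x * deriv F (φ x) + e * F (φ x) = G (φ x)) :
    IsEulerOn φ V (fun x => g x * F (φ x)) (fun x => g x * G (φ x)) := by
  intro x hx
  obtain ⟨h1, h2⟩ := hg x hx
  have hd := h1.hasDerivAt.mul ((hF x hx).hasDerivAt.comp x (hφ x hx).hasDerivAt)
  refine ⟨hd.differentiableAt, ?_⟩
  have e1 : deriv (fun x => g x * F (φ x)) x =
    deriv g x * F (φ x) + g x * (deriv F (φ x) * deriv φ x) := hd.deriv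
  rw [e1]
  have h0 := hφ' x hx
  have h3 := hG x hx
  have : φ x * ((deriv g x * F (φ x) + g x * (deriv F (φ x) * deriv φ x)) / deriv φ x)
    = (φ x * (deriv g x / deriv φ x)) * F (φ x) + g x * (φ x * deriv F (φ x)) := by
    field_simp
  rw [this, h2]
  linear_combination g x * h3

/-! ### Power series with polynomially bounded coefficients -/

theorem summable_of_poly_bound {b : ℕ → ℂ} {C : ℝ} {k : ℕ}
    (hb : ∀ n, ‖b n‖ ≤ C * ((n : ℝ) + 1) ^ k) {z : ℂ} (hz : ‖z‖ < 1) :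
    Summable (fun n => b n * z ^ n) := by
  -- The shift to n + 1 is what dominates the term n = 0, where n ^ k may vanish.
  have hs : Summable (fun n : ℕ => ((n + 1 : ℕ) : ℝ) ^ k * ‖z‖ ^ (n + 1)) :=
    (summable_nat_add_iff (f := fun n : ℕ => (n : ℝ) ^ k * ‖z‖ ^ n) 1).2
      (summable_pow_mul_geometric_of_norm_lt_one k (by simpa using hz))
  by_cases h0 : z = 0
  · subst h0
    refine summable_of_ne_finset_zero (s := {0}) (fun n hn => ?_)
    simp [Finset.mem_singleton] at hn
    simp [hn]
  refine Summable.of_norm_bounded (hs.mul_left (C / ‖z‖)) (fun n => ?_)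
  have hz0 : 0 < ‖z‖ := norm_pos_iff.2 h0
  rw [norm_mul, norm_pow, pow_succ]
  have : C / ‖z‖ * (((n + 1 : ℕ) : ℝ) ^ k * (‖z‖ ^ n * ‖z‖)) =
      C * ((n : ℝ) + 1) ^ k * ‖z‖ ^ n := by
    push_cast; field_simp
  rw [this]
  exact mul_le_mul_of_nonneg_right (hb n) (by positivity)

/-- On power series, z d/dz + e multiplies the n-th coefficient by n + e. Polynomial growth is thus
stable under the operator, and the unit disk remains a domain of convergence. -/
theorem poly_bound_mul_add {b : ℕ → ℂ} {C : ℝ} {k : ℕ}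
    (hb : ∀ n, ‖b n‖ ≤ C * ((n : ℝ) + 1) ^ k) (e : ℂ) :
    ∀ n : ℕ, ‖((n : ℂ) + e) * b n‖ ≤ C * (1 + ‖e‖) * ((n : ℝ) + 1) ^ (k + 1) := by
  intro n
  have h1 : ‖(n : ℂ) + e‖ ≤ (1 + ‖e‖) * ((n : ℝ) + 1) := by
    refine (norm_add_le _ _).trans ?_
    rw [Complex.norm_natCast]
    nlinarith [norm_nonneg e, (Nat.cast_nonneg n : (0 : ℝ) ≤ n)]
  rw [norm_mul]
  calc _ ≤ ((1 + ‖e‖) * ((n : ℝ) + 1)) * (C * ((n : ℝ) + 1) ^ k) :=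
        mul_le_mul h1 (hb n) (norm_nonneg _) (by positivity)
    _ = _ := by ring

theorem hasDerivAt_tsum_of_poly_bound {b : ℕ → ℂ} {C : ℝ} {k : ℕ}
    (hb : ∀ n, ‖b n‖ ≤ C * ((n : ℝ) + 1) ^ k) {z : ℂ} (hz : ‖z‖ < 1) :
    HasDerivAt (fun z => ∑' n, b n * z ^ n) (∑' n : ℕ, b n * ((n : ℂ) * z ^ (n - 1))) z := by
  obtain ⟨ρ, hzρ, hρ⟩ := exists_between hz
  have hρ0 : 0 < ρ := (norm_nonneg z).trans_lt hzρ
  -- On the disk of radius ρ the differentiated terms are dominated by n ‖bₙ‖ ρⁿ / ρ, which is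
  -- summable by the case e = 0 of the growth bound.
  have hs := (summable_of_poly_bound (poly_bound_mul_add hb 0) (z := (ρ : ℂ))
    (by simpa [abs_of_pos hρ0] using hρ)).norm
  refine hasDerivAt_tsum_of_isPreconnected (u := fun n : ℕ => ‖((n : ℂ) + 0) * b n * (ρ : ℂ) ^ n‖ / ρ)
    (hs.div_const ρ) (t := Metric.ball 0 ρ) (y₀ := 0) Metric.isOpen_ball
    (convex_ball 0 ρ).isPreconnected (fun n y _ => (hasDerivAt_pow n y).const_mul (b n)) ?_
    (by simpa using hρ0) (summable_of_poly_bound hb (by simp)) (by simpa using hzρ)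
  intro n y hy
  have hy' : ‖y‖ ≤ ρ := by simpa using (Metric.mem_ball.1 hy).le
  rcases Nat.eq_zero_or_pos n with rfl | hn
  · simp
  obtain ⟨m, rfl⟩ : ∃ m, n = m + 1 := ⟨n - 1, by omega⟩
  simp only [add_zero, norm_mul, norm_pow, Complex.norm_real, Real.norm_eq_abs, abs_of_pos hρ0,
    Nat.add_sub_cancel]
  have : ‖((m + 1 : ℕ) : ℂ)‖ * ‖b (m + 1)‖ * ρ ^ (m + 1) / ρ =
    ‖b (m + 1)‖ * (‖((m + 1 : ℕ) : ℂ)‖ * ρ ^ m) := by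
    rw [pow_succ]; field_simp
  rw [this]
  gcongr

theorem euler_tsum_of_poly_bound {b : ℕ → ℂ} {C : ℝ} {k : ℕ}
    (hb : ∀ n, ‖b n‖ ≤ C * ((n : ℝ) + 1) ^ k) (e : ℂ) {z : ℂ} (hz : ‖z‖ < 1) :
    z * deriv (fun z => ∑' n, b n * z ^ n) z + e * ∑' n, b n * z ^ n =
      ∑' n : ℕ, (((n : ℂ) + e) * b n) * z ^ n := by
  rw [(hasDerivAt_tsum_of_poly_bound hb hz).deriv, ← tsum_mul_left, ← tsum_mul_left]
  have e1 : ∀ n : ℕ, z * (b n * ((n : ℂ) * z ^ (n - 1))) = (((n : ℂ) + 0) * b n) * z ^ n := by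
    intro n
    rcases n with _ | m
    · simp
    · rw [Nat.add_sub_cancel, pow_succ]; ring
  simp only [e1]
  rw [← Summable.tsum_add (summable_of_poly_bound (poly_bound_mul_add hb 0) hz)
    ((summable_of_poly_bound hb hz).mul_left e)]
  exact tsum_congr fun n => by ring

/-! ### The hypergeometric series -/

theorem hyp32Coeff_succ {a₁ a₂ a₃ b₁ b₂ : ℂ} (n : ℕ) (h₁ : b₁ + n ≠ 0) (h₂ : b₂ + n ≠ 0) :
    (b₁ + n) * (b₂ + n) * (n + 1) * hyp32Coeff a₁ a₂ a₃ b₁ b₂ (n + 1) =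
      (a₁ + n) * (a₂ + n) * (a₃ + n) * hyp32Coeff a₁ a₂ a₃ b₁ b₂ n := by
  simp only [hyp32Coeff, ascPochhammer_succ_eval, Nat.factorial_succ, Nat.cast_mul, Nat.cast_add,
    Nat.cast_one]
  have h3 : (n : ℂ) + 1 ≠ 0 := Nat.cast_add_one_ne_zero n
  -- If an earlier Pochhammer factor vanishes, both coefficients are 0 by the convention x / 0 = 0.
  by_cases hz : (ascPochhammer ℂ n).eval b₁ * (ascPochhammer ℂ n).eval b₂ * (n.factorial : ℂ) = 0
  · have : (ascPochhammer ℂ n).eval b₁ * (b₁ + n) * ((ascPochhammer ℂ n).eval b₂ * (b₂ + n)) *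
      (((n : ℂ) + 1) * (n.factorial : ℂ)) = 0 := by
      linear_combination (b₁ + n) * (b₂ + n) * ((n : ℂ) + 1) * hz
    rw [hz, this]; simp
  · have hz' := hz
    simp only [mul_eq_zero, not_or] at hz'
    obtain ⟨⟨h4, h5⟩, h6⟩ := hz'
    field_simp

/-- The ratio of consecutive coefficients has modulus at most 1: pair a₁ with b₁, a₃ with b₂, and a₂
with the 1 coming from n!. -/
theorem norm_hyp32Coeff_le_one {a₁ a₂ a₃ b₁ b₂ : ℝ} (h₁ : |a₁| ≤ b₁) (h₂ : |a₂| ≤ 1)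
    (h₃ : |a₃| ≤ b₂) (hb₁ : 0 < b₁) (hb₂ : 0 < b₂) (n : ℕ) :
    ‖hyp32Coeff a₁ a₂ a₃ b₁ b₂ n‖ ≤ 1 := by
  induction n with
  | zero => simp [hyp32Coeff]
  | succ n ih =>
    have hn : (0 : ℝ) ≤ n := Nat.cast_nonneg n
    have hr := hyp32Coeff_succ (a₁ := a₁) (a₂ := a₂) (a₃ := a₃) (b₁ := b₁) (b₂ := b₂) n
      (by exact_mod_cast (by positivity : b₁ + n ≠ 0)) (by exact_mod_cast (by positivity : b₂ + n ≠ 0))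
    have hN := congrArg norm hr
    simp only [norm_mul] at hN
    have nb : ∀ c : ℝ, ‖(c : ℂ) + n‖ = |c + n| := fun c => by
      rw [← Complex.ofReal_natCast, ← Complex.ofReal_add, Complex.norm_real, Real.norm_eq_abs]
    have n1 : ‖(n : ℂ) + 1‖ = n + 1 := by
      have := Complex.norm_natCast (n + 1); push_cast at this; exact this
    rw [nb, nb, nb, nb, nb, n1, abs_of_pos (by positivity : 0 < b₁ + n),
      abs_of_pos (by positivity : 0 < b₂ + n)] at hN
    have key : ∀ a b : ℝ, |a| ≤ b → |a + n| ≤ b + n := fun a b h =>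
      (abs_add_le _ _).trans (by rw [abs_of_nonneg hn]; linarith)
    have hle : |a₁ + n| * |a₂ + n| * |a₃ + n| ≤ (b₁ + n) * (b₂ + n) * (n + 1) := by
      rw [mul_right_comm]
      refine mul_le_mul (mul_le_mul (key _ _ h₁) (key _ _ h₃) (abs_nonneg _) (by positivity)) ?_
        (abs_nonneg _) (by positivity)
      linarith [key _ _ h₂]
    have hpos : 0 < (b₁ + n) * (b₂ + n) * ((n : ℝ) + 1) := by positivity
    refine le_of_mul_le_mul_left ?_ hpos
    rw [hN, mul_one]
    calc _ ≤ (|a₁ + n| * |a₂ + n| * |a₃ + n|) * 1 :=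
          mul_le_mul_of_nonneg_left ih (by positivity)
      _ ≤ _ := by rw [mul_one]; exact hle

/-- If `g` has exponent `e` for the Euler operator in `z = φ x`, then `g · ₃F₂(φ)` with parameters
shifted by `e` solves the pulled-back equation. -/
theorem hypEqAt_mul_hyp32 {a₁ a₂ a₃ b₁ b₂ c₁ c₂ e : ℂ} {φ g : ℂ → ℂ} {V : Set ℂ} (hV : IsOpen V)
    (hφ : ∀ x ∈ V, DifferentiableAt ℂ φ x) (hφ' : ∀ x ∈ V, deriv φ x ≠ 0)
    (hφ0 : ∀ x ∈ V, φ x ≠ 0) (hφ1 : ∀ x ∈ V, ‖φ x‖ < 1)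
    (hg : IsEulerOn φ V g (fun x => e * g x))
    (hb : ∀ n, ‖hyp32Coeff (a₁ + e) (a₂ + e) (a₃ + e) c₁ c₂ n‖ ≤ 1)
    (hc₁ : ∀ n : ℕ, c₁ + n ≠ 0) (hc₂ : ∀ n : ℕ, c₂ + n ≠ 0)
    (hind : ∀ t : ℂ, (t + e) * (t + e + (b₁ - 1)) * (t + e + (b₂ - 1)) =
      t * (t + (c₁ - 1)) * (t + (c₂ - 1))) {x : ℂ} (hx : x ∈ V) :
    HypEqAt a₁ a₂ a₃ b₁ b₂ φ
      (fun x => g x * hyp32 (a₁ + e) (a₂ + e) (a₃ + e) c₁ c₂ (φ x)) x := by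
  set c := hyp32Coeff (a₁ + e) (a₂ + e) (a₃ + e) c₁ c₂ with hc
  have B0 : ∀ n, ‖c n‖ ≤ 1 * ((n : ℝ) + 1) ^ 0 := fun n => by simpa using hb n
  have B1 := poly_bound_mul_add B0 e
  have B2 := poly_bound_mul_add B1 e
  have B3 := poly_bound_mul_add B2 e
  have S0 := summable_of_poly_bound B0 (hφ1 x hx)
  have S1 := summable_of_poly_bound B1 (hφ1 x hx)
  have S2 := summable_of_poly_bound B2 (hφ1 x hx)
  have S3 := summable_of_poly_bound B3 (hφ1 x hx)
  have E1 := isEulerOn_mul_comp hφ hφ' hg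
    (fun y hy => (hasDerivAt_tsum_of_poly_bound B0 (hφ1 y hy)).differentiableAt)
    (G := fun z => ∑' n : ℕ, (((n : ℂ) + e) * c n) * z ^ n)
    (fun y hy => euler_tsum_of_poly_bound B0 e (hφ1 y hy))
  have E2 := isEulerOn_mul_comp hφ hφ' hg
    (fun y hy => (hasDerivAt_tsum_of_poly_bound B1 (hφ1 y hy)).differentiableAt)
    (G := fun z => ∑' n : ℕ, (((n : ℂ) + e) * (((n : ℂ) + e) * c n)) * z ^ n)
    (fun y hy => euler_tsum_of_poly_bound B1 e (hφ1 y hy))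
  have E3 := isEulerOn_mul_comp hφ hφ' hg
    (fun y hy => (hasDerivAt_tsum_of_poly_bound B2 (hφ1 y hy)).differentiableAt)
    (G := fun z => ∑' n : ℕ, (((n : ℂ) + e) * (((n : ℂ) + e) * (((n : ℂ) + e) * c n))) * z ^ n)
    (fun y hy => euler_tsum_of_poly_bound B2 e (hφ1 y hy))
  refine (hypEqAt_iff_of_isEulerOn hV E1 E2 E3 hx (hφ0 x hx)).2 ?_
  set z := φ x
  have key : ∀ k₂ k₁ k₀ : ℂ,
      (∑' n : ℕ, (((n : ℂ) + e) * (((n : ℂ) + e) * (((n : ℂ) + e) * c n))) * z ^ n) +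
      k₂ * (∑' n : ℕ, (((n : ℂ) + e) * (((n : ℂ) + e) * c n)) * z ^ n) +
      k₁ * (∑' n : ℕ, (((n : ℂ) + e) * c n) * z ^ n) + k₀ * (∑' n : ℕ, c n * z ^ n) =
      ∑' n : ℕ, ((((n : ℂ) + e) ^ 3 + k₂ * ((n : ℂ) + e) ^ 2 + k₁ * ((n : ℂ) + e) + k₀) * c n)
        * z ^ n := by
    intro k₂ k₁ k₀
    rw [← tsum_mul_left, ← tsum_mul_left, ← tsum_mul_left, ← S3.tsum_add (S2.mul_left _),
      ← (S3.add (S2.mul_left _)).tsum_add (S1.mul_left _),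
      ← ((S3.add (S2.mul_left _)).add (S1.mul_left _)).tsum_add (S0.mul_left _)]
    exact tsum_congr fun n => by ring
  have sum3 : ∀ k₂ k₁ k₀ : ℂ, Summable (fun n : ℕ =>
      ((((n : ℂ) + e) ^ 3 + k₂ * ((n : ℂ) + e) ^ 2 + k₁ * ((n : ℂ) + e) + k₀) * c n) * z ^ n) :=
    fun k₂ k₁ k₀ => (((S3.add (S2.mul_left k₂)).add (S1.mul_left k₁)).add (S0.mul_left k₀)).congr
      fun n => by ring
  have L := key (a₁ + a₂ + a₃) (a₁ * a₂ + a₁ * a₃ + a₂ * a₃) (a₁ * a₂ * a₃)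
  have R := key ((b₁ - 1) + (b₂ - 1)) ((b₁ - 1) * (b₂ - 1)) 0
  have shift : z * (∑' n : ℕ, ((((n : ℂ) + e) ^ 3 + (a₁ + a₂ + a₃) * ((n : ℂ) + e) ^ 2 +
      (a₁ * a₂ + a₁ * a₃ + a₂ * a₃) * ((n : ℂ) + e) + a₁ * a₂ * a₃) * c n) * z ^ n) =
      ∑' n : ℕ, ((((n : ℂ) + e) ^ 3 + ((b₁ - 1) + (b₂ - 1)) * ((n : ℂ) + e) ^ 2 +
      ((b₁ - 1) * (b₂ - 1)) * ((n : ℂ) + e) + 0) * c n) * z ^ n := by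
    -- Multiplication by z matches the n-th term on the left with the (n+1)-st on the right. The
    -- unmatched term n = 0 vanishes because e is a root of the indicial polynomial, which is `hind`
    -- at t = 0.
    rw [(sum3 ((b₁ - 1) + (b₂ - 1)) ((b₁ - 1) * (b₂ - 1)) 0).tsum_eq_zero_add, ← tsum_mul_left]
    have h0 := hind 0
    have z0 : ((((0 : ℕ) : ℂ) + e) ^ 3 + ((b₁ - 1) + (b₂ - 1)) * (((0 : ℕ) : ℂ) + e) ^ 2 +
      ((b₁ - 1) * (b₂ - 1)) * (((0 : ℕ) : ℂ) + e) + 0) * c 0 * z ^ 0 = 0 := by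
      push_cast
      linear_combination c 0 * h0
    rw [z0, zero_add]
    refine tsum_congr fun n => ?_
    have h1 := hind ((n + 1 : ℕ) : ℂ)
    have h2 := hyp32Coeff_succ (a₁ := a₁ + e) (a₂ := a₂ + e) (a₃ := a₃ + e) n (hc₁ n) (hc₂ n)
    rw [← hc] at h2
    push_cast at h1 ⊢
    linear_combination (-z ^ (n + 1)) * h2 - z ^ (n + 1) * c (n + 1) * h1
  calc _ = z * g x * (∑' n : ℕ, ((((n : ℂ) + e) ^ 3 + (a₁ + a₂ + a₃) * ((n : ℂ) + e) ^ 2 +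
      (a₁ * a₂ + a₁ * a₃ + a₂ * a₃) * ((n : ℂ) + e) + a₁ * a₂ * a₃) * c n) * z ^ n) := by
        rw [← L]; ring
    _ = g x * ∑' n : ℕ, ((((n : ℂ) + e) ^ 3 + ((b₁ - 1) + (b₂ - 1)) * ((n : ℂ) + e) ^ 2 +
      ((b₁ - 1) * (b₂ - 1)) * ((n : ℂ) + e) + 0) * c n) * z ^ n := by rw [← shift]; ring
    _ = _ := by rw [← R]; ring

/-! ### Third order equations and Wronskians -/

/-- The Wronskian determinant of three functions. -/
noncomputable def wronskian3 (u v w : ℂ → ℂ) (x : ℂ) : ℂ :=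
  u x * (deriv v x * deriv (deriv w) x - deriv (deriv v) x * deriv w x) -
    deriv u x * (v x * deriv (deriv w) x - deriv (deriv v) x * w x) +
    deriv (deriv u) x * (v x * deriv w x - deriv v x * w x)

/-- `u''' = α u'' + β u' + γ u` at the point `x`. -/
def ThirdOrderEqAt (α β γ : ℂ → ℂ) (u : ℂ → ℂ) (x : ℂ) : Prop :=
  deriv (deriv (deriv u)) x = α x * deriv (deriv u) x + β x * deriv u x + γ x * u x

theorem differentiableOn_wronskian3 {U : Set ℂ} (hU : IsOpen U) {u v w : ℂ → ℂ}
    (hu : DifferentiableOn ℂ u U) (hv : DifferentiableOn ℂ v U) (hw : DifferentiableOn ℂ w U) :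
    DifferentiableOn ℂ (wronskian3 u v w) U := by
  have hu1 := hu.deriv hU
  have hv1 := hv.deriv hU
  have hw1 := hw.deriv hU
  have hu2 := hu1.deriv hU
  have hv2 := hv1.deriv hU
  have hw2 := hw1.deriv hU
  unfold wronskian3
  fun_prop

/-- Abel's identity. -/
theorem hasDerivAt_wronskian3 {U : Set ℂ} (hU : IsOpen U) {α β γ u v w : ℂ → ℂ}
    (hu : DifferentiableOn ℂ u U) (hv : DifferentiableOn ℂ v U) (hw : DifferentiableOn ℂ w U)
    {x : ℂ} (hx : x ∈ U) (eu : ThirdOrderEqAt α β γ u x) (ev : ThirdOrderEqAt α β γ v x)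
    (ew : ThirdOrderEqAt α β γ w x) :
    HasDerivAt (wronskian3 u v w) (α x * wronskian3 u v w x) x := by
  have hn := hU.mem_nhds hx
  have d0 : ∀ {f : ℂ → ℂ}, DifferentiableOn ℂ f U → HasDerivAt f (deriv f x) x :=
    fun hf => (hf.differentiableAt hn).hasDerivAt
  have u0 := d0 hu
  have u1 := d0 (hu.deriv hU)
  have u2 := d0 ((hu.deriv hU).deriv hU)
  have v0 := d0 hv
  have v1 := d0 (hv.deriv hU)
  have v2 := d0 ((hv.deriv hU).deriv hU)
  have w0 := d0 hw
  have w1 := d0 (hw.deriv hU)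
  have w2 := d0 ((hw.deriv hU).deriv hU)
  unfold ThirdOrderEqAt at eu ev ew
  have := ((u0.mul ((v1.mul w2).sub (v2.mul w1))).sub (u1.mul ((v0.mul w2).sub (v2.mul w0)))).add
    (u2.mul ((v0.mul w1).sub (v1.mul w0)))
  refine HasDerivAt.congr_deriv this ?_
  rw [eu, ev, ew]
  simp only [wronskian3, Pi.mul_apply, Pi.sub_apply]
  ring

/-- The quotient of two solutions of f' = αf has zero derivative off 0. The quotient is holomorphic,
so its derivative is continuous and vanishes at 0 as well; no condition on α or on the equation at 0
is needed. -/
theorem eq_const_mul_of_abel {U : Set ℂ} (hU : IsOpen U) (hc : IsPreconnected U)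
    {α f g : ℂ → ℂ} (hf : DifferentiableOn ℂ f U) (hg : DifferentiableOn ℂ g U)
    (hg0 : ∀ x ∈ U, g x ≠ 0)
    (ef : ∀ x ∈ U, x ≠ 0 → HasDerivAt f (α x * f x) x)
    (eg : ∀ x ∈ U, x ≠ 0 → HasDerivAt g (α x * g x) x) :
    ∃ c : ℂ, ∀ x ∈ U, f x = c * g x := by
  have hq : DifferentiableOn ℂ (fun x => f x / g x) U := hf.div hg hg0
  have hd : ∀ x ∈ U, x ≠ 0 → deriv (fun x => f x / g x) x = 0 := by
    intro x hx h0
    have := ((ef x hx h0).div (eg x hx h0) (hg0 x hx)).deriv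
    have e : deriv (fun x => f x / g x) x = _ := this
    rw [e]
    have := hg0 x hx
    field_simp
    ring
  have hd' : Set.EqOn (deriv (fun x => f x / g x)) 0 U := by
    intro x hx
    by_cases h0 : x = 0
    · subst h0
      have hcont : ContinuousAt (deriv (fun x => f x / g x)) 0 :=
        ((hq.deriv hU).differentiableAt (hU.mem_nhds hx)).continuousAt
      have hev : deriv (fun x => f x / g x) =ᶠ[𝓝[≠] 0] 0 := by
        filter_upwards [nhdsWithin_le_nhds (hU.mem_nhds hx), self_mem_nhdsWithin] with y hy hy0
        exact hd y hy hy0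
      exact ((hcont.eventuallyEq_nhds_iff_eventuallyEq_nhdsNE continuousAt_const).1 hev).eq_of_nhds
    · exact hd x hx h0
  rcases U.eq_empty_or_nonempty with rfl | ⟨x₀, hx₀⟩
  · exact ⟨0, by simp⟩
  refine ⟨f x₀ / g x₀, fun x hx => ?_⟩
  have := hU.is_const_of_deriv_eq_zero hc hq hd' hx hx₀
  rw [← this]
  field_simp [hg0 x hx]

/-- Replacing one uᵢ by u in the Wronskian gives a function with the same Abel equation, hence a
constant multiple of the Wronskian. By Cramer's rule these constants are the coefficients of u. -/
theorem exists_linear_combination_of_thirdOrderEqAt {U : Set ℂ} (hU : IsOpen U)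
    (hc : IsPreconnected U) {α β γ u u₀ u₁ u₂ : ℂ → ℂ} (hu : DifferentiableOn ℂ u U)
    (h₀ : DifferentiableOn ℂ u₀ U) (h₁ : DifferentiableOn ℂ u₁ U) (h₂ : DifferentiableOn ℂ u₂ U)
    (hW : ∀ x ∈ U, wronskian3 u₀ u₁ u₂ x ≠ 0)
    (e : ∀ x ∈ U, x ≠ 0 → ThirdOrderEqAt α β γ u x)
    (e₀ : ∀ x ∈ U, x ≠ 0 → ThirdOrderEqAt α β γ u₀ x)
    (e₁ : ∀ x ∈ U, x ≠ 0 → ThirdOrderEqAt α β γ u₁ x)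
    (e₂ : ∀ x ∈ U, x ≠ 0 → ThirdOrderEqAt α β γ u₂ x) :
    ∃ c₀ c₁ c₂ : ℂ, ∀ x ∈ U, u x = c₀ * u₀ x + c₁ * u₁ x + c₂ * u₂ x := by
  have hg := differentiableOn_wronskian3 hU h₀ h₁ h₂
  have eg : ∀ x ∈ U, x ≠ 0 → _ := fun x hx h =>
    hasDerivAt_wronskian3 hU h₀ h₁ h₂ hx (e₀ x hx h) (e₁ x hx h) (e₂ x hx h)
  obtain ⟨c₀, k₀⟩ := eq_const_mul_of_abel hU hc (differentiableOn_wronskian3 hU hu h₁ h₂) hg hW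
    (fun x hx h => hasDerivAt_wronskian3 hU hu h₁ h₂ hx (e x hx h) (e₁ x hx h) (e₂ x hx h)) eg
  obtain ⟨c₁, k₁⟩ := eq_const_mul_of_abel hU hc (differentiableOn_wronskian3 hU h₀ hu h₂) hg hW
    (fun x hx h => hasDerivAt_wronskian3 hU h₀ hu h₂ hx (e₀ x hx h) (e x hx h) (e₂ x hx h)) eg
  obtain ⟨c₂, k₂⟩ := eq_const_mul_of_abel hU hc (differentiableOn_wronskian3 hU h₀ h₁ hu) hg hW
    (fun x hx h => hasDerivAt_wronskian3 hU h₀ h₁ hu hx (e₀ x hx h) (e₁ x hx h) (e x hx h)) eg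
  refine ⟨c₀, c₁, c₂, fun x hx => mul_left_cancel₀ (hW x hx) ?_⟩
  -- Expansion of a 4 × 4 determinant in which the row of values is repeated.
  have cramer : wronskian3 u₀ u₁ u₂ x * u x = wronskian3 u u₁ u₂ x * u₀ x +
      wronskian3 u₀ u u₂ x * u₁ x + wronskian3 u₀ u₁ u x * u₂ x := by
    simp only [wronskian3]; ring
  rw [cramer, k₀ x hx, k₁ x hx, k₂ x hx]
  ring

/-- A linear combination whose `2`-jet vanishes at a point with nonzero Wronskian is trivial. -/
theorem eq_zero_of_wronskian3_ne_zero {u₀ u₁ u₂ : ℂ → ℂ} {x c₀ c₁ c₂ : ℂ}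
    (hW : wronskian3 u₀ u₁ u₂ x ≠ 0)
    (h₀ : c₀ * u₀ x + c₁ * u₁ x + c₂ * u₂ x = 0)
    (h₁ : c₀ * deriv u₀ x + c₁ * deriv u₁ x + c₂ * deriv u₂ x = 0)
    (h₂ : c₀ * deriv (deriv u₀) x + c₁ * deriv (deriv u₁) x + c₂ * deriv (deriv u₂) x = 0) :
    c₀ = 0 ∧ c₁ = 0 ∧ c₂ = 0 := by
  unfold wronskian3 at hW
  refine ⟨mul_left_cancel₀ hW ?_, mul_left_cancel₀ hW ?_, mul_left_cancel₀ hW ?_⟩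
  · linear_combination (deriv u₁ x * deriv (deriv u₂) x - deriv (deriv u₁) x * deriv u₂ x) * h₀ -
      (u₁ x * deriv (deriv u₂) x - deriv (deriv u₁) x * u₂ x) * h₁ +
      (u₁ x * deriv u₂ x - deriv u₁ x * u₂ x) * h₂
  · linear_combination -(deriv u₀ x * deriv (deriv u₂) x - deriv (deriv u₀) x * deriv u₂ x) * h₀ +
      (u₀ x * deriv (deriv u₂) x - deriv (deriv u₀) x * u₂ x) * h₁ -
      (u₀ x * deriv u₂ x - deriv u₀ x * u₂ x) * h₂
  · linear_combination (deriv u₀ x * deriv (deriv u₁) x - deriv (deriv u₀) x * deriv u₁ x) * h₀ -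
      (u₀ x * deriv (deriv u₁) x - deriv (deriv u₀) x * u₁ x) * h₁ +
      (u₀ x * deriv u₁ x - deriv u₀ x * u₁ x) * h₂

theorem deriv_linear_combination_eqOn {U : Set ℂ} (hU : IsOpen U) {u u₀ u₁ u₂ : ℂ → ℂ}
    (h₀ : DifferentiableOn ℂ u₀ U) (h₁ : DifferentiableOn ℂ u₁ U) (h₂ : DifferentiableOn ℂ u₂ U)
    {c₀ c₁ c₂ : ℂ} (h : ∀ x ∈ U, u x = c₀ * u₀ x + c₁ * u₁ x + c₂ * u₂ x) :
    ∀ x ∈ U, deriv u x = c₀ * deriv u₀ x + c₁ * deriv u₁ x + c₂ * deriv u₂ x := by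
  intro x hx
  have hn := hU.mem_nhds hx
  have e : u =ᶠ[𝓝 x] fun x => c₀ * u₀ x + c₁ * u₁ x + c₂ * u₂ x := by
    filter_upwards [hn] with y hy using h y hy
  rw [e.deriv_eq]
  exact ((((h₀.differentiableAt hn).hasDerivAt.const_mul c₀).add
    ((h₁.differentiableAt hn).hasDerivAt.const_mul c₁)).add
    ((h₂.differentiableAt hn).hasDerivAt.const_mul c₂)).deriv

theorem ThirdOrderEqAt.linear_combination {U : Set ℂ} (hU : IsOpen U)
    {α β γ u u₀ u₁ u₂ : ℂ → ℂ}
    (h₀ : DifferentiableOn ℂ u₀ U) (h₁ : DifferentiableOn ℂ u₁ U) (h₂ : DifferentiableOn ℂ u₂ U)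
    {c₀ c₁ c₂ : ℂ} (h : ∀ x ∈ U, u x = c₀ * u₀ x + c₁ * u₁ x + c₂ * u₂ x) {x : ℂ} (hx : x ∈ U)
    (e₀ : ThirdOrderEqAt α β γ u₀ x) (e₁ : ThirdOrderEqAt α β γ u₁ x)
    (e₂ : ThirdOrderEqAt α β γ u₂ x) : ThirdOrderEqAt α β γ u x := by
  have d1 := deriv_linear_combination_eqOn hU h₀ h₁ h₂ h
  have d2 := deriv_linear_combination_eqOn hU (h₀.deriv hU) (h₁.deriv hU) (h₂.deriv hU) d1
  have d3 := deriv_linear_combination_eqOn hU ((h₀.deriv hU).deriv hU) ((h₁.deriv hU).deriv hU)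
    ((h₂.deriv hU).deriv hU) d2
  unfold ThirdOrderEqAt at *
  rw [d3 x hx, d2 x hx, d1 x hx, h x hx, e₀, e₁, e₂]
  ring

theorem eq_zero_of_linear_combination_eq_zero {U : Set ℂ} (hU : IsOpen U) {u₀ u₁ u₂ : ℂ → ℂ}
    (h₀ : DifferentiableOn ℂ u₀ U) (h₁ : DifferentiableOn ℂ u₁ U) (h₂ : DifferentiableOn ℂ u₂ U)
    {c₀ c₁ c₂ : ℂ} (h : ∀ x ∈ U, c₀ * u₀ x + c₁ * u₁ x + c₂ * u₂ x = 0) {x : ℂ} (hx : x ∈ U)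
    (hW : wronskian3 u₀ u₁ u₂ x ≠ 0) : c₀ = 0 ∧ c₁ = 0 ∧ c₂ = 0 := by
  have h' : ∀ x ∈ U, (0 : ℂ → ℂ) x = c₀ * u₀ x + c₁ * u₁ x + c₂ * u₂ x := fun x hx => (h x hx).symm
  have d1 := deriv_linear_combination_eqOn hU h₀ h₁ h₂ h'
  have d2 := deriv_linear_combination_eqOn hU (h₀.deriv hU) (h₁.deriv hU) (h₂.deriv hU) d1
  have z : deriv (0 : ℂ → ℂ) = 0 := deriv_zero
  refine eq_zero_of_wronskian3_ne_zero hW (h x hx) ?_ ?_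
  · rw [← d1 x hx, z]; rfl
  · rw [← d2 x hx, z, z]; rfl

/-! ### Polynomials given by coefficient lists -/

/-- The polynomial with coefficient list `l` (constant term first), evaluated by Horner's rule. -/
noncomputable def horner : List ℂ → ℂ → ℂ
  | [], _ => 0
  | c :: l, x => c + x * horner l x

/-- The derivative of `horner l`. -/
noncomputable def hornerDeriv : List ℂ → ℂ → ℂ
  | [], _ => 0
  | _ :: l, x => horner l x + x * hornerDeriv l x

/-- Formal differentiation of the list lets every identity involving derivatives of the explicit
polynomials be unfolded and closed by `ring`. -/
theorem hasDerivAt_horner (l : List ℂ) (x : ℂ) : HasDerivAt (horner l) (hornerDeriv l x) x := by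
  induction l with
  | nil => exact hasDerivAt_const x 0
  | cons c l ih =>
    refine HasDerivAt.congr_deriv (((hasDerivAt_id x).mul ih).const_add c) ?_
    simp [hornerDeriv]

theorem continuous_horner (l : List ℂ) : Continuous (horner l) :=
  continuous_iff_continuousAt.2 fun x => (hasDerivAt_horner l x).continuousAt

/-- The denominator factor of `Ψ₃`, equal to `7 P₃`. -/
noncomputable def polyP : List ℂ := [7, -7, 0, 1]
/-- The numerator factor of `Ψ₃`, equal to `-1372 Q₃`. -/
noncomputable def polyA : List ℂ := [-1372, 3087, -2058, -294, 980, -441, 66]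
/-- The ramification factor: `Ψ₃ - 1` is divisible by `polyR ^ 2`. -/
noncomputable def polyR : List ℂ := [-588, 1862, -2205, 588, 1365, -1750, 945, -252, 27]
/-- The radicand of `Y₀`, times `3`. -/
noncomputable def polyT : List ℂ := [3, -2]
/-- The radicand of `S`. -/
noncomputable def polyB : List ℂ := [7, 0, -21 / 4, 0, 1]
/-- The numerator of `Ψ₃ / Ψ₃'`, whose denominator is `49 polyR`. -/
noncomputable def polyN : List ℂ := [0, -9604, 31213, -36015, 10976, 12005, -12005, 3255, 518,
  -441, 66]
/-- The numerator of the derivative of `polyN / polyR`. -/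
noncomputable def polyK : List ℂ := [5647152, -36706488, 100472246, -148641108, 126405447,
  -69076770, 60284308, -104628720, 130863075, -101032512, 45588914, -6419196, -6379359, 5254830,
  -2046156, 471744, -61803, 3564]
/-- Coefficient of `u` in the pulled-back equation. -/
noncomputable def polyODE0 : List ℂ := [-15435 / 8, 97755 / 16, -231525 / 32, 15435 / 8, 143325 /
  32, -91875 / 16, 99225 / 32, -6615 / 8, 2835 / 32]
/-- Coefficient of `u'` in the pulled-back equation. -/
noncomputable def polyODE1 : List ℂ := [-3087 / 4, 8673 / 4, -19551 / 16, -15141 / 8, 20601 / 8,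
  -2499 / 4, -7203 / 16, 1743 / 8, 9, -12]
/-- Coefficient of `u''` in the pulled-back equation. -/
noncomputable def polyODE2 : List ℂ := [-147 / 2, -931 / 4, 4599 / 8, -168, -1953 / 8, 259 / 2, 27
  / 2, -12]

theorem polyN_eq (x : ℂ) : horner polyN x = x * horner polyA x * horner polyP x := by
  simp only [polyN, polyA, polyP, horner]; ring

theorem polyK_eq (x : ℂ) : horner polyK x =
    hornerDeriv polyN x * horner polyR x - horner polyN x * hornerDeriv polyR x := by
  simp only [polyN, polyK, polyR, horner, hornerDeriv]; ring

/-- The fibre of `Ψ₃` over `1`. -/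
theorem branch_identity (x : ℂ) : x ^ 3 * horner polyA x ^ 3 - 1728 * horner polyP x ^ 7 =
    -196 * (horner polyR x ^ 2 * horner polyT x * horner polyB x) := by
  simp only [polyA, polyP, polyR, polyT, polyB, horner]; ring

/-- The left side is the numerator of Ψ'/Ψ over the common denominator xAP. The factor R reappears
because Ψ' vanishes at the double points of the fibre over 1. -/
theorem deriv_identity (x : ℂ) : 3 * horner polyA x * horner polyP x +
    3 * x * hornerDeriv polyA x * horner polyP x - 7 * x * horner polyA x * hornerDeriv polyP x =
    49 * horner polyR x := by
  simp only [polyA, polyP, polyR, horner, hornerDeriv]; ring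

/-- Put ρ = Ψ/Ψ' = N/(49R), so that z d/dz = ρ d/dx. The coefficient of u'' is 3(Ψ - 1)ρ²ρ' + (Ψ/2 +
1)ρ², and the left side is its numerator with ρ²/(1728P⁷) factored out. Divisibility by R expresses
that the roots of R are only apparent singularities. -/
theorem ode2_identity (x : ℂ) : -12 * (horner polyT x * horner polyB x * horner polyK x) +
    (x ^ 3 * horner polyA x ^ 3 / 2 + 1728 * horner polyP x ^ 7) =
    -4 * (horner polyR x * x * horner polyA x * horner polyODE2 x) := by
  simp only [polyA, polyP, polyR, polyT, polyB, polyK, polyODE2, horner]; ring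

/-- The same for the coefficient of u', namely (Ψ - 1)ρ(ρ'² + ρρ'') + (Ψ/2 + 1)ρρ' + (Ψ/28 - 2/9)ρ.
-/
theorem ode1_identity (x : ℂ) :
    -(4 / 49) * (horner polyT x * horner polyB x * (horner polyK x ^ 2 + horner polyN x *
      (hornerDeriv polyK x * horner polyR x - 2 * horner polyK x * hornerDeriv polyR x))) +
    (x ^ 3 * horner polyA x ^ 3 / 2 + 1728 * horner polyP x ^ 7) * horner polyK x / 49 +
    horner polyR x ^ 2 * (x ^ 3 * horner polyA x ^ 3 / 28 - 2 / 9 * (1728 * horner polyP x ^ 7)) =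
    -(4 / 49) * (x ^ 2 * horner polyA x ^ 2 * horner polyR x ^ 2 * horner polyODE1 x) := by
  simp only [polyA, polyP, polyR, polyT, polyB, polyK, polyN, polyODE1, horner, hornerDeriv]; ring

/-- The constant is 15·49³/(2744·196), where -15/2744 is the product of the upper parameters. -/
theorem ode0_identity (x : ℂ) : horner polyODE0 x = 105 / 32 * horner polyR x := by
  simp only [polyODE0, polyR, horner]; ring

/-! ### The covering and the equation in the variable x -/

theorem Psi3_eq (x : ℂ) : Psi3 x = x ^ 3 * horner polyA x ^ 3 / (1728 * horner polyP x ^ 7) := by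
  have h1 : horner polyA x = (3 * x ^ 2 - 7) * (2 * x ^ 2 - 7 * x + 7) *
      (11 * x ^ 2 - 35 * x + 28) := by
    simp only [polyA, horner]; ring
  have h2 : horner polyP x = x ^ 3 - 7 * x + 7 := by
    simp only [polyP, horner]; ring
  rw [Psi3, h1, h2]; ring

theorem P3_eq (x : ℂ) : P3 x = horner polyP x / 7 := by
  simp only [P3, polyP, horner]; ring

theorem Q3_eq (x : ℂ) : Q3 x = -(horner polyA x / 1372) := by
  simp only [Q3, polyA, horner]; ring

theorem hasDerivAt_Psi3 {x : ℂ} (hp : horner polyP x ≠ 0) :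
    HasDerivAt Psi3 (49 * x ^ 2 * horner polyA x ^ 2 * horner polyR x /
      (1728 * horner polyP x ^ 8)) x := by
  have h := (((hasDerivAt_pow 3 x).mul ((hasDerivAt_horner polyA x).pow 3)).div
    (((hasDerivAt_horner polyP x).pow 7).const_mul 1728)
    (mul_ne_zero (by norm_num) (pow_ne_zero 7 hp)))
  refine HasDerivAt.congr_of_eventuallyEq (HasDerivAt.congr_deriv h ?_)
    (Eventually.of_forall Psi3_eq)
  simp only [Pi.pow_apply, Pi.mul_apply]
  push_cast
  field_simp
  linear_combination x ^ 2 * horner polyA x ^ 2 * deriv_identity x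

/-- The punctured neighbourhood data needed to write the equation in the variable `x`. -/
def IsRegularAt (x : ℂ) : Prop :=
  x ≠ 0 ∧ horner polyP x ≠ 0 ∧ horner polyA x ≠ 0 ∧ horner polyR x ≠ 0 ∧ horner polyT x ≠ 0 ∧
    horner polyB x ≠ 0

theorem IsRegularAt.Psi3_ne_zero {x : ℂ} (h : IsRegularAt x) : Psi3 x ≠ 0 := by
  obtain ⟨h1, h2, h3, -⟩ := h
  rw [Psi3_eq]
  simp [h1, h2, h3]

theorem IsRegularAt.deriv_Psi3_ne_zero {x : ℂ} (h : IsRegularAt x) : deriv Psi3 x ≠ 0 := by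
  obtain ⟨h1, h2, h3, h4, -⟩ := h
  rw [(hasDerivAt_Psi3 h2).deriv]
  simp [h1, h2, h3, h4]

theorem isEulerOn_Psi3 {V : Set ℂ} (hV : ∀ x ∈ V, IsRegularAt x) {u u' : ℂ → ℂ}
    (hu : ∀ x ∈ V, HasDerivAt u (u' x) x) :
    IsEulerOn Psi3 V u (fun x => horner polyN x / (49 * horner polyR x) * u' x) := by
  intro x hx
  obtain ⟨h1, h2, h3, h4, -⟩ := hV x hx
  refine ⟨(hu x hx).differentiableAt, ?_⟩
  simp only [(hu x hx).deriv, (hasDerivAt_Psi3 h2).deriv, Psi3_eq, polyN_eq]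
  field_simp

/-- The pulled-back hypergeometric equation for `u = Y / √P₃`, with denominators cleared. -/
theorem hypEqAt_iff_ode {V : Set ℂ} (hVo : IsOpen V) (hV : ∀ x ∈ V, IsRegularAt x)
    {u u₁ u₂ u₃ : ℂ → ℂ} (h₁ : ∀ x ∈ V, HasDerivAt u (u₁ x) x)
    (h₂ : ∀ x ∈ V, HasDerivAt u₁ (u₂ x) x) (h₃ : ∀ x ∈ V, HasDerivAt u₂ (u₃ x) x)
    {x : ℂ} (hx : x ∈ V) :
    HypEqAt (-1 / 14) (3 / 14) (5 / 14) (1 / 3) (2 / 3) Psi3 u x ↔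
      horner polyP x ^ 3 * horner polyT x * horner polyB x * u₃ x +
        horner polyP x ^ 2 * horner polyODE2 x * u₂ x +
        horner polyP x * horner polyODE1 x * u₁ x + horner polyODE0 x * u x = 0 := by
  set ρ : ℂ → ℂ := fun x => horner polyN x / (49 * horner polyR x) with hρ
  set ρ₁ : ℂ → ℂ := fun x => horner polyK x / (49 * horner polyR x ^ 2) with hρ₁
  set ρ₂ : ℂ → ℂ := fun x => (hornerDeriv polyK x * horner polyR x -
    2 * horner polyK x * hornerDeriv polyR x) / (49 * horner polyR x ^ 3) with hρ₂
  have dρ : ∀ x ∈ V, HasDerivAt ρ (ρ₁ x) x := by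
    intro x hx
    obtain ⟨-, -, -, h4, -⟩ := hV x hx
    refine HasDerivAt.congr_deriv ((hasDerivAt_horner polyN x).div
      ((hasDerivAt_horner polyR x).const_mul 49) (by simpa using h4)) ?_
    simp only [hρ₁, polyK_eq]
    field_simp
  have dρ₁ : ∀ x ∈ V, HasDerivAt ρ₁ (ρ₂ x) x := by
    intro x hx
    obtain ⟨-, -, -, h4, -⟩ := hV x hx
    refine HasDerivAt.congr_deriv ((hasDerivAt_horner polyK x).div
      (((hasDerivAt_horner polyR x).pow 2).const_mul 49) (by simpa using h4)) ?_
    simp only [hρ₂]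
    push_cast
    field_simp
  have E₁ := isEulerOn_Psi3 hV h₁
  have E₂ := isEulerOn_Psi3 hV (fun y hy => (dρ y hy).mul (h₂ y hy))
  have E₃ := isEulerOn_Psi3 hV (fun y hy => (dρ y hy).mul
    (((dρ₁ y hy).mul (h₂ y hy)).add ((dρ y hy).mul (h₃ y hy))))
  rw [hypEqAt_iff_of_isEulerOn (v₁ := fun x => ρ x * u₁ x)
    (v₂ := fun x => ρ x * (ρ₁ x * u₁ x + ρ x * u₂ x))
    (v₃ := fun x => ρ x * (ρ₁ x * (ρ₁ x * u₁ x + ρ x * u₂ x) +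
      ρ x * (ρ₂ x * u₁ x + ρ₁ x * u₂ x + (ρ₁ x * u₂ x + ρ x * u₃ x))))
    hVo E₁ E₂ E₃ hx (hV x hx).Psi3_ne_zero]
  obtain ⟨h1, h2, h3, h4, h5, h6⟩ := hV x hx
  have I := branch_identity x
  have I2 := ode2_identity x
  have I1 := ode1_identity x
  have I0 := ode0_identity x
  have hN := polyN_eq x
  have hΨ := Psi3_eq x
  simp only [hρ, hρ₁, hρ₂]
  -- From here the polynomials are atoms, related only by the identities just collected; expanding
  -- them would make the field arithmetic unmanageable.
  generalize hornerDeriv polyK x = K' at *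
  generalize hornerDeriv polyR x = R' at *
  generalize horner polyK x = K at *
  generalize horner polyR x = R at *
  generalize horner polyP x = P at *
  generalize horner polyA x = A at *
  generalize horner polyT x = T at *
  generalize horner polyB x = B at *
  generalize horner polyN x = N at *
  generalize horner polyODE0 x = N₀ at *
  generalize horner polyODE1 x = N₁ at *
  generalize horner polyODE2 x = N₂ at *
  generalize Psi3 x = φ at *
  -- The common factor of the four coefficients, chosen so that (Ψ - 1)ρ³ becomes M·P³TB.
  set M : ℂ := -196 * x ^ 3 * A ^ 3 / (1728 * 49 ^ 3 * P ^ 7 * R) with hM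
  have hM0 : M ≠ 0 := by simp [hM, h1, h2, h3, h4]
  have hφ : φ - 1 = -196 * (R ^ 2 * T * B) / (1728 * P ^ 7) := by
    rw [← I, hΨ]; field_simp
  have c3 : (φ - 1) * (N / (49 * R)) ^ 3 = M * (P ^ 3 * T * B) := by
    rw [hφ, hN, hM]; field_simp
  have c2 : (φ - 1) * (3 * (N / (49 * R)) ^ 2 * (K / (49 * R ^ 2))) +
      (φ / 2 + 1) * (N / (49 * R)) ^ 2 = M * (P ^ 2 * N₂) := by
    have : (φ - 1) * (3 * (N / (49 * R)) ^ 2 * (K / (49 * R ^ 2))) +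
      (φ / 2 + 1) * (N / (49 * R)) ^ 2 = (N / (49 * R)) ^ 2 / (1728 * P ^ 7) *
        (-12 * (T * B * K) + (x ^ 3 * A ^ 3 / 2 + 1728 * P ^ 7)) := by
      rw [hφ, hΨ]; field_simp; ring
    rw [this, I2, hN, hM]; field_simp; ring
  have c1 : (φ - 1) * ((N / (49 * R)) * ((K / (49 * R ^ 2)) ^ 2 +
      (N / (49 * R)) * ((K' * R - 2 * K * R') / (49 * R ^ 3)))) +
      (φ / 2 + 1) * ((N / (49 * R)) * (K / (49 * R ^ 2))) + (φ / 28 - 2 / 9) * (N / (49 * R)) =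
      M * (P * N₁) := by
    have : (φ - 1) * ((N / (49 * R)) * ((K / (49 * R ^ 2)) ^ 2 +
      (N / (49 * R)) * ((K' * R - 2 * K * R') / (49 * R ^ 3)))) +
      (φ / 2 + 1) * ((N / (49 * R)) * (K / (49 * R ^ 2))) + (φ / 28 - 2 / 9) * (N / (49 * R)) =
      N / (49 * R ^ 3 * (1728 * P ^ 7)) *
      (-(4 / 49) * (T * B * (K ^ 2 + N * (K' * R - 2 * K * R'))) +
        (x ^ 3 * A ^ 3 / 2 + 1728 * P ^ 7) * K / 49 +
        R ^ 2 * (x ^ 3 * A ^ 3 / 28 - 2 / 9 * (1728 * P ^ 7))) := by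
      rw [hφ, hΨ]; field_simp; ring
    rw [this, I1, hN, hM]; field_simp; ring
  have c0 : -(15 / 2744) * φ = M * N₀ := by
    rw [hΨ, I0, hM]; field_simp; ring
  constructor
  · intro h
    refine mul_left_cancel₀ hM0 ?_
    linear_combination h - u₃ x * c3 - u₂ x * c2 - u₁ x * c1 - u x * c0
  · intro h
    linear_combination M * h + u₃ x * c3 + u₂ x * c2 + u₁ x * c1 + u x * c0

/-! ### Derivatives of the algebraic functions and verification of the equation -/

/-- Numerators of the successive derivatives of `x * h x`, `h = Y₀ / √P₃`. -/
noncomputable def linNum : ℕ → List ℂ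
  | 0 => [0, 1]
  | 1 => [21, -63 / 2, 14, -3 / 2]
  | 2 => [147, -441 / 4, -378, 1281 / 2, -378, 363 / 4, -6]
  | _ => [33957 / 4, -226821 / 8, 80703 / 2, -292383 / 8, 120687 / 4, -191247 / 8, 27489 / 2,
      -37029 / 8, 753, -36]

/-- Numerators (part free of the radical) of the derivatives of
`(2 x² - 3 x + 2 s) * h`, `h = Y₁ / √P₃`. -/
noncomputable def radNumA : ℕ → List ℂ
  | 0 => [0, -3, 2]
  | 1 => [-147, 441 / 2, 49 / 4, -1239 / 8, 105 / 2, 189 / 8, -14, 3 / 2]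
  | 2 => [0, -21609 / 4, 46305 / 4, -11319 / 8, -210945 / 16, 510531 / 64, 148029 / 32, -162141 /
      32, -1029 / 16, 79527 / 64, -8463 / 32, -1575 / 16, 315 / 8, -3]
  | _ => [-1058841 / 4, 5899257 / 8, -9529569 / 16, -4084101 / 32, 39378801 / 64, -95461359 / 128,
      92565753 / 256, 236389083 / 512, -41920431 / 64, 16839585 / 512, 83576409 / 256, -62072367 /
      512, -1149393 / 16, 25020135 / 512, 496419 / 128, -271929 / 32, 35931 / 32, 16905 / 32, -609
      / 4, 9]

/-- Numerators (coefficient of the radical) of the derivatives of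
`(2 x² - 3 x + 2 s) * h`, `h = Y₁ / √P₃`. -/
noncomputable def radNumB : ℕ → List ℂ
  | 0 => [2]
  | 1 => [49, -147 / 2, 105 / 4, 21 / 2, -35 / 4, 3 / 2]
  | 2 => [0, 3087, -25725 / 4, 19551 / 8, 112455 / 32, -24549 / 8, -1029 / 16, 1617 / 2, -6573 /
      32, -441 / 8, 231 / 8, -3]
  | _ => [151263, -403368, 3579891 / 8, -2542659 / 8, 136857 / 64, 59691261 / 128, -122040429 /
      256, -3411135 / 128, 71236641 / 256, -798063 / 8, -14571963 / 256, 5185719 / 128, 389991 /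
      256, -828345 / 128, 68985 / 64, 11109 / 32, -483 / 4, 9]

theorem hasDerivAt_mul_of_logDeriv {g h : ℂ → ℂ} {g' l x : ℂ} (hg : HasDerivAt g g' x)
    (hh : HasDerivAt h (l * h x) x) :
    HasDerivAt (fun y => g y * h y) ((g' + g x * l) * h x) x :=
  HasDerivAt.congr_deriv (hg.mul hh) (by ring)

/-- The quotient rule for N/(TP)^k · h with h'/h = -1/T - P'/(2P). The bound on k is needed because
the list stays constant from index 3 on. -/
theorem linNum_succ {k : ℕ} (hk : k < 3) (x : ℂ) : horner (linNum (k + 1)) x =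
    hornerDeriv (linNum k) x * (horner polyT x * horner polyP x) -
    k * horner (linNum k) x *
      (hornerDeriv polyT x * horner polyP x + horner polyT x * hornerDeriv polyP x) -
    horner (linNum k) x * (horner polyP x + horner polyT x * hornerDeriv polyP x / 2) := by
  interval_cases k <;>
  · simp only [linNum, polyT, polyP, horner, hornerDeriv]
    push_cast
    ring

theorem hasDerivAt_linNum {h : ℂ → ℂ} {x : ℂ} (hp : horner polyP x ≠ 0) (hT : horner polyT x ≠ 0)
    (hh : HasDerivAt h ((-1 / horner polyT x - hornerDeriv polyP x / (2 * horner polyP x)) * h x) x)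
    {k : ℕ} (hk : k < 3) :
    HasDerivAt (fun x => horner (linNum k) x / (horner polyT x * horner polyP x) ^ k * h x)
      (horner (linNum (k + 1)) x / (horner polyT x * horner polyP x) ^ (k + 1) * h x) x := by
  have hd := ((hasDerivAt_horner (linNum k) x).div
    (((hasDerivAt_horner polyT x).mul (hasDerivAt_horner polyP x)).pow k)
    (pow_ne_zero k (mul_ne_zero hT hp)))
  refine HasDerivAt.congr_deriv (hasDerivAt_mul_of_logDeriv hd hh) ?_
  rw [linNum_succ hk]
  simp only [Pi.mul_apply, Pi.pow_apply]
  interval_cases k <;>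
  · field_simp
    push_cast
    ring

/-- With s² = B and h'/h = -x/(2s) - P'/(2P), rewriting -x/(2s) as -xs/(2B) makes the rational part
and the coefficient of s feed into each other. -/
theorem radNumA_succ {k : ℕ} (hk : k < 3) (x : ℂ) : horner (radNumA (k + 1)) x =
    hornerDeriv (radNumA k) x * (horner polyP x * horner polyB x) -
    horner (radNumA k) x * (k * (hornerDeriv polyP x * horner polyB x +
      horner polyP x * hornerDeriv polyB x) + horner polyB x * hornerDeriv polyP x / 2) -
    x * horner polyP x * horner polyB x * horner (radNumB k) x / 2 := by
  interval_cases k <;>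
  · simp only [radNumA, radNumB, polyB, polyP, horner, hornerDeriv]
    push_cast
    ring

theorem radNumB_succ {k : ℕ} (hk : k < 3) (x : ℂ) : horner (radNumB (k + 1)) x =
    hornerDeriv (radNumB k) x * (horner polyP x * horner polyB x) +
    horner (radNumB k) x * hornerDeriv polyB x * horner polyP x / 2 -
    horner (radNumB k) x * (k * (hornerDeriv polyP x * horner polyB x +
      horner polyP x * hornerDeriv polyB x) + horner polyB x * hornerDeriv polyP x / 2) -
    x * horner polyP x * horner (radNumA k) x / 2 := by
  interval_cases k <;>
  · simp only [radNumA, radNumB, polyB, polyP, horner, hornerDeriv]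
    push_cast
    ring

/-- The root s of B is left arbitrary so that s = S and s = -S give the two conjugate solutions. -/
theorem hasDerivAt_radNum {s h : ℂ → ℂ} {x : ℂ} (hp : horner polyP x ≠ 0) (hs0 : s x ≠ 0)
    (hs2 : s x ^ 2 = horner polyB x) (hs : HasDerivAt s (hornerDeriv polyB x / (2 * s x)) x)
    (hh : HasDerivAt h ((-x / (2 * s x) - hornerDeriv polyP x / (2 * horner polyP x)) * h x) x)
    {k : ℕ} (hk : k < 3) :
    HasDerivAt (fun x => (horner (radNumA k) x + horner (radNumB k) x * s x) /
        (horner polyP x * horner polyB x) ^ k * h x)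
      ((horner (radNumA (k + 1)) x + horner (radNumB (k + 1)) x * s x) /
        (horner polyP x * horner polyB x) ^ (k + 1) * h x) x := by
  have hB : horner polyB x ≠ 0 := by rw [← hs2]; exact pow_ne_zero 2 hs0
  have hd := (((hasDerivAt_horner (radNumA k) x).add
    ((hasDerivAt_horner (radNumB k) x).mul hs)).div
    (((hasDerivAt_horner polyP x).mul (hasDerivAt_horner polyB x)).pow k)
    (pow_ne_zero k (mul_ne_zero hp hB)))
  refine HasDerivAt.congr_deriv (hasDerivAt_mul_of_logDeriv hd hh) ?_
  rw [radNumA_succ hk, radNumB_succ hk]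
  simp only [Pi.mul_apply, Pi.pow_apply, Pi.add_apply, ← hs2]
  interval_cases k <;>
  · field_simp
    push_cast
    ring

theorem linNum_ode (x : ℂ) : horner polyB x * horner (linNum 3) x +
    horner polyODE2 x * horner (linNum 2) x +
    horner polyT x * horner polyODE1 x * horner (linNum 1) x +
    horner polyT x ^ 2 * horner polyODE0 x * horner (linNum 0) x = 0 := by
  simp only [linNum, polyT, polyB, polyODE0, polyODE1, polyODE2, horner]
  ring

/-- The rational part and the coefficient of s in the equation vanish separately, so the sign of s
is immaterial. -/
theorem radNumA_ode (x : ℂ) : horner polyT x * horner (radNumA 3) x +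
    horner polyODE2 x * horner (radNumA 2) x +
    horner polyB x * horner polyODE1 x * horner (radNumA 1) x +
    horner polyB x ^ 2 * horner polyODE0 x * horner (radNumA 0) x = 0 := by
  simp only [radNumA, polyT, polyB, polyODE0, polyODE1, polyODE2, horner]
  ring

theorem radNumB_ode (x : ℂ) : horner polyT x * horner (radNumB 3) x +
    horner polyODE2 x * horner (radNumB 2) x +
    horner polyB x * horner polyODE1 x * horner (radNumB 1) x +
    horner polyB x ^ 2 * horner polyODE0 x * horner (radNumB 0) x = 0 := by
  simp only [radNumB, polyT, polyB, polyODE0, polyODE1, polyODE2, horner]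
  ring

theorem hypEqAt_lin {V : Set ℂ} (hVo : IsOpen V) (hV : ∀ x ∈ V, IsRegularAt x) {h : ℂ → ℂ}
    (hh : ∀ x ∈ V, HasDerivAt h
      ((-1 / horner polyT x - hornerDeriv polyP x / (2 * horner polyP x)) * h x) x)
    {x : ℂ} (hx : x ∈ V) :
    HypEqAt (-1 / 14) (3 / 14) (5 / 14) (1 / 3) (2 / 3) Psi3
      (fun x => horner (linNum 0) x / (horner polyT x * horner polyP x) ^ 0 * h x) x := by
  have key : ∀ k < 3, ∀ x ∈ V, _ := fun k hk x hx =>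
    hasDerivAt_linNum (hV x hx).2.1 (hV x hx).2.2.2.2.1 (hh x hx) hk
  rw [hypEqAt_iff_ode hVo hV (key 0 (by norm_num)) (key 1 (by norm_num)) (key 2 (by norm_num)) hx]
  obtain ⟨h1, h2, h3, h4, h5, h6⟩ := hV x hx
  have := linNum_ode x
  simp only [zero_add, Nat.reduceAdd]
  field_simp
  linear_combination h x * this

theorem hypEqAt_rad {V : Set ℂ} (hVo : IsOpen V) (hV : ∀ x ∈ V, IsRegularAt x) {s h : ℂ → ℂ}
    (hs2 : ∀ x ∈ V, s x ^ 2 = horner polyB x)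
    (hs : ∀ x ∈ V, HasDerivAt s (hornerDeriv polyB x / (2 * s x)) x)
    (hh : ∀ x ∈ V, HasDerivAt h
      ((-x / (2 * s x) - hornerDeriv polyP x / (2 * horner polyP x)) * h x) x)
    {x : ℂ} (hx : x ∈ V) :
    HypEqAt (-1 / 14) (3 / 14) (5 / 14) (1 / 3) (2 / 3) Psi3
      (fun x => (horner (radNumA 0) x + horner (radNumB 0) x * s x) /
        (horner polyP x * horner polyB x) ^ 0 * h x) x := by
  have hs0 : ∀ x ∈ V, s x ≠ 0 := fun x hx h => (hV x hx).2.2.2.2.2 (by rw [← hs2 x hx, h]; ring)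
  have key : ∀ k < 3, ∀ x ∈ V, _ := fun k hk x hx =>
    hasDerivAt_radNum (hV x hx).2.1 (hs0 x hx) (hs2 x hx) (hs x hx) (hh x hx) hk
  rw [hypEqAt_iff_ode hVo hV (key 0 (by norm_num)) (key 1 (by norm_num)) (key 2 (by norm_num)) hx]
  obtain ⟨h1, h2, h3, h4, h5, h6⟩ := hV x hx
  have eA := radNumA_ode x
  have eB := radNumB_ode x
  simp only [zero_add, Nat.reduceAdd]
  field_simp
  linear_combination h x * eA + h x * s x * eB

/-! ### Principal branches near x = 0 -/

theorem hasDerivAt_cpow_const_of_mem_slitPlane {f : ℂ → ℂ} {f' x : ℂ} (c : ℂ)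
    (hf : HasDerivAt f f' x) (hx : f x ∈ Complex.slitPlane) :
    HasDerivAt (fun y => f y ^ c) (c * f' / f x * f x ^ c) x := by
  refine HasDerivAt.congr_deriv (hf.cpow_const hx) ?_
  have h0 := Complex.slitPlane_ne_zero hx
  rw [Complex.cpow_sub _ _ h0, Complex.cpow_one]
  field_simp

theorem cpow_half_sq (z : ℂ) : (z ^ (1 / 2 : ℂ)) ^ 2 = z := by
  have := Complex.cpow_nat_inv_pow z (n := 2) (by norm_num)
  rw [one_div]
  exact_mod_cast this

theorem s7_sq : s7 ^ 2 = 7 := by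
  rw [s7, ← Complex.ofReal_pow, Real.sq_sqrt (by norm_num)]
  norm_num

theorem s7_ne_zero : s7 ≠ 0 := fun h => by simpa [h] using s7_sq

theorem add_s7_ne_zero : 21 + 8 * s7 ≠ 0 := fun h => by
  have := s7_sq
  have h' : s7 = -21 / 8 := by linear_combination h / 8
  norm_num [h'] at this

theorem sub_s7_ne_zero : 21 - 8 * s7 ≠ 0 := fun h => by
  have := s7_sq
  have h' : s7 = 21 / 8 := by linear_combination -h / 8
  norm_num [h'] at this

theorem S_zero : S 0 = s7 := by
  rw [S, s7, Real.sqrt_eq_rpow, Complex.ofReal_cpow (by norm_num)]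
  norm_num

theorem polyB_eq (x : ℂ) : 7 - 21 / 4 * x ^ 2 + x ^ 4 = horner polyB x := by
  simp only [polyB, horner]; ring

theorem S_sq (x : ℂ) : S x ^ 2 = horner polyB x := by
  rw [S, cpow_half_sq, polyB_eq]

/-- All radicands avoid the branch cut and no polynomial factor of the pull-back vanishes,
except possibly `x` itself. -/
def IsTameAt (x : ℂ) : Prop :=
  (horner polyP x ≠ 0 ∧ horner polyA x ≠ 0 ∧ horner polyR x ≠ 0 ∧ horner polyT x ≠ 0) ∧
    P3 x ∈ Complex.slitPlane ∧ 1 - 2 * x / 3 ∈ Complex.slitPlane ∧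
    7 - 21 / 4 * x ^ 2 + x ^ 4 ∈ Complex.slitPlane ∧
    (21 - 8 * x ^ 2 + 8 * S x) / (21 + 8 * s7) ∈ Complex.slitPlane ∧
    (21 - 8 * x ^ 2 - 8 * S x) / (21 - 8 * s7) ∈ Complex.slitPlane

theorem IsTameAt.polyB_ne_zero {x : ℂ} (h : IsTameAt x) : horner polyB x ≠ 0 := by
  rw [← polyB_eq]; exact Complex.slitPlane_ne_zero h.2.2.2.1

theorem IsTameAt.isRegularAt {x : ℂ} (h : IsTameAt x) (hx : x ≠ 0) : IsRegularAt x :=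
  ⟨hx, h.1.1, h.1.2.1, h.1.2.2.1, h.1.2.2.2, h.polyB_ne_zero⟩

theorem IsTameAt.S_ne_zero {x : ℂ} (h : IsTameAt x) : S x ≠ 0 := fun h0 =>
  h.polyB_ne_zero (by rw [← S_sq, h0]; ring)

theorem hasDerivAt_S {x : ℂ} (h : 7 - 21 / 4 * x ^ 2 + x ^ 4 ∈ Complex.slitPlane) :
    HasDerivAt S (hornerDeriv polyB x / (2 * S x)) x := by
  have hB : horner polyB x ≠ 0 := by rw [← polyB_eq]; exact Complex.slitPlane_ne_zero h
  have e : S = fun x => horner polyB x ^ (1 / 2 : ℂ) := funext fun y => by rw [S, polyB_eq]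
  have hS : S x ≠ 0 := fun h0 => hB (by rw [← S_sq, h0]; ring)
  have h2 := hasDerivAt_cpow_const_of_mem_slitPlane (1 / 2) (hasDerivAt_horner polyB x)
    (by rw [← polyB_eq]; exact h)
  rw [← e] at h2
  refine h2.congr_deriv ?_
  have : horner polyB x ^ (1 / 2 : ℂ) = S x := by rw [e]
  rw [this, ← S_sq]
  field_simp

theorem isTameAt_zero : IsTameAt 0 := by
  refine ⟨⟨?_, ?_, ?_, ?_⟩, ?_, ?_, ?_, ?_, ?_⟩
  · norm_num [polyP, horner]
  · norm_num [polyA, horner]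
  · norm_num [polyR, horner]
  · norm_num [polyT, horner]
  · norm_num [P3]
  · norm_num
  · left; norm_num
  · rw [S_zero]
    norm_num [div_self add_s7_ne_zero]
  · rw [S_zero]
    norm_num [div_self sub_s7_ne_zero]

theorem eventually_isTameAt : ∀ᶠ x in 𝓝 (0 : ℂ), IsTameAt x := by
  obtain ⟨⟨h1, h2, h3, h4⟩, h5, h6, h7, h8, h9⟩ := isTameAt_zero
  have ne : ∀ l : List ℂ, horner l 0 ≠ 0 → ∀ᶠ x in 𝓝 (0 : ℂ), horner l x ≠ 0 := fun l h =>
    (continuous_horner l).continuousAt.eventually_ne h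
  have sl : ∀ f : ℂ → ℂ, ContinuousAt f 0 → f 0 ∈ Complex.slitPlane →
      ∀ᶠ x in 𝓝 (0 : ℂ), f x ∈ Complex.slitPlane := fun f hf h =>
    hf.eventually_mem (Complex.isOpen_slitPlane.mem_nhds h)
  have hS : ContinuousAt S 0 := (hasDerivAt_S h7).continuousAt
  exact ((ne _ h1).and ((ne _ h2).and ((ne _ h3).and (ne _ h4)))).and
    ((sl P3 (by unfold P3; fun_prop) h5).and ((sl (fun x => 1 - 2 * x / 3) (by fun_prop) h6).and
      ((sl (fun x => 7 - 21 / 4 * x ^ 2 + x ^ 4) (by fun_prop) h7).and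
        ((sl (fun x => (21 - 8 * x ^ 2 + 8 * S x) / (21 + 8 * s7)) (by fun_prop) h8).and
          (sl (fun x => (21 - 8 * x ^ 2 - 8 * S x) / (21 - 8 * s7)) (by fun_prop) h9)))))

/-! ### Logarithmic derivatives of the radicals -/

theorem hasDerivAt_P3 (x : ℂ) : HasDerivAt P3 (hornerDeriv polyP x / 7) x :=
  ((hasDerivAt_horner polyP x).div_const 7).congr_of_eventuallyEq (Eventually.of_forall P3_eq)

theorem hasDerivAt_Q3 (x : ℂ) : HasDerivAt Q3 (-(hornerDeriv polyA x / 1372)) x :=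
  ((hasDerivAt_horner polyA x).div_const 1372).neg.congr_of_eventuallyEq
    (Eventually.of_forall Q3_eq)

theorem hasDerivAt_P3_cpow {x : ℂ} (h : P3 x ∈ Complex.slitPlane) (c : ℂ) :
    HasDerivAt (fun x => P3 x ^ c) (c * hornerDeriv polyP x / horner polyP x * P3 x ^ c) x := by
  refine (hasDerivAt_cpow_const_of_mem_slitPlane c (hasDerivAt_P3 x) h).congr_deriv ?_
  have h0 := Complex.slitPlane_ne_zero h
  rw [P3_eq] at h0
  have : horner polyP x ≠ 0 := fun h => h0 (by rw [h]; ring)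
  congr 1
  rw [P3_eq]
  field_simp

theorem hasDerivAt_Y0 {x : ℂ} (h : IsTameAt x) :
    HasDerivAt Y0 (-1 / horner polyT x * Y0 x) x := by
  have hd : HasDerivAt (fun x : ℂ => 1 - 2 * x / 3) (-(2 / 3)) x := by
    refine ((((hasDerivAt_id x).const_mul 2).div_const 3).const_sub 1).congr_deriv (by ring)
  refine (hasDerivAt_cpow_const_of_mem_slitPlane (1 / 2) hd h.2.2.1).congr_deriv ?_
  have h0 := h.1.2.2.2
  have e : 1 - 2 * x / 3 = horner polyT x / 3 := by simp only [polyT, horner]; ring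
  rw [Y0, e]
  field_simp

/-- For D = 21 - 8x² + 8S one has D' = -2xD/S, because S² = B gives SS' = 2x³ - 21x/4. The fourth
root divides this logarithmic derivative by 4. -/
theorem hasDerivAt_Y1 {x : ℂ} (h : IsTameAt x) :
    HasDerivAt Y1 (-x / (2 * S x) * Y1 x) x := by
  have hS := h.S_ne_zero
  have hd : HasDerivAt (fun x : ℂ => (21 - 8 * x ^ 2 + 8 * S x) / (21 + 8 * s7))
      ((-(16 * x) + 8 * (hornerDeriv polyB x / (2 * S x))) / (21 + 8 * s7)) x := by
    refine ((((((hasDerivAt_pow 2 x).const_mul 8).const_sub 21)).add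
      ((hasDerivAt_S h.2.2.2.1).const_mul 8)).div_const _).congr_deriv ?_
    push_cast; ring
  refine (hasDerivAt_cpow_const_of_mem_slitPlane (1 / 4) hd h.2.2.2.2.1).congr_deriv ?_
  have h0 := add_s7_ne_zero
  have h1 : 21 - 8 * x ^ 2 + 8 * S x ≠ 0 := fun e =>
    Complex.slitPlane_ne_zero h.2.2.2.2.1 (by rw [e]; simp)
  generalize hD : 21 - 8 * x ^ 2 + 8 * S x = D at *
  have e : hornerDeriv polyB x = 4 * x ^ 3 - 21 / 2 * x := by
    simp only [polyB, horner, hornerDeriv]; ring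
  rw [Y1, e, hD]
  congr 1
  field_simp
  linear_combination -8 * x * hD

theorem hasDerivAt_Y2 {x : ℂ} (h : IsTameAt x) :
    HasDerivAt Y2 (x / (2 * S x) * Y2 x) x := by
  have hS := h.S_ne_zero
  have hd : HasDerivAt (fun x : ℂ => (21 - 8 * x ^ 2 - 8 * S x) / (21 - 8 * s7))
      ((-(16 * x) - 8 * (hornerDeriv polyB x / (2 * S x))) / (21 - 8 * s7)) x := by
    refine ((((((hasDerivAt_pow 2 x).const_mul 8).const_sub 21)).sub
      ((hasDerivAt_S h.2.2.2.1).const_mul 8)).div_const _).congr_deriv ?_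
    push_cast; ring
  refine (hasDerivAt_cpow_const_of_mem_slitPlane (1 / 4) hd h.2.2.2.2.2).congr_deriv ?_
  have h0 := sub_s7_ne_zero
  have h1 : 21 - 8 * x ^ 2 - 8 * S x ≠ 0 := fun e =>
    Complex.slitPlane_ne_zero h.2.2.2.2.2 (by rw [e]; simp)
  generalize hD : 21 - 8 * x ^ 2 - 8 * S x = D at *
  have e : hornerDeriv polyB x = 4 * x ^ 3 - 21 / 2 * x := by
    simp only [polyB, horner, hornerDeriv]; ring
  rw [Y2, e, hD]
  congr 1
  field_simp
  linear_combination 8 * x * hD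

theorem hasDerivAt_div_sqrt_P3 {x l c : ℂ} {f : ℂ → ℂ} (h : P3 x ∈ Complex.slitPlane)
    (hf : HasDerivAt f (l * f x) x) :
    HasDerivAt (fun x => c * (f x / P3 x ^ (1 / 2 : ℂ)))
      ((l - hornerDeriv polyP x / (2 * horner polyP x)) * (c * (f x / P3 x ^ (1 / 2 : ℂ)))) x := by
  have h0 : P3 x ^ (1 / 2 : ℂ) ≠ 0 := by
    simp [Complex.cpow_eq_zero_iff, Complex.slitPlane_ne_zero h]
  have hp : horner polyP x ≠ 0 := fun e => Complex.slitPlane_ne_zero h (by rw [P3_eq, e]; simp)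
  refine ((hf.div (hasDerivAt_P3_cpow h (1 / 2)) h0).const_mul c).congr_deriv ?_
  field_simp

/-! ### The three algebraic solutions, divided by `√P₃` -/

/-- The three algebraic solutions, divided by `√P₃`. -/
noncomputable def algSol : Fin 3 → ℂ → ℂ :=
  ![fun x => x * Y0 x / P3 x ^ (1 / 2 : ℂ), fun x => W1 x * Y1 x / P3 x ^ (1 / 2 : ℂ),
    fun x => W2 x * Y2 x / P3 x ^ (1 / 2 : ℂ)]

/-- The `k`-th derivatives (`k ≤ 3`) of the three algebraic solutions, divided by `√P₃`. -/
noncomputable def algJet (k : ℕ) : Fin 3 → ℂ → ℂ :=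
  ![fun x => horner (linNum k) x / (horner polyT x * horner polyP x) ^ k *
      (1 * (Y0 x / P3 x ^ (1 / 2 : ℂ))),
    fun x => (horner (radNumA k) x + horner (radNumB k) x * S x) /
      (horner polyP x * horner polyB x) ^ k * (1 / (2 * s7) * (Y1 x / P3 x ^ (1 / 2 : ℂ))),
    fun x => (horner (radNumA k) x + horner (radNumB k) x * (-S x)) /
      (horner polyP x * horner polyB x) ^ k * (-1 / (2 * s7) * (Y2 x / P3 x ^ (1 / 2 : ℂ)))]

theorem algSol_eq_algJet (i : Fin 3) : algSol i = algJet 0 i := by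
  have := s7_ne_zero
  funext x
  fin_cases i
  · simp only [algSol, algJet, linNum, horner, Matrix.cons_val, Fin.zero_eta]
    ring
  · simp only [algSol, algJet, W1, radNumA, radNumB, horner, Matrix.cons_val, Fin.mk_one]
    field_simp
    ring
  · simp only [algSol, algJet, W2, radNumA, radNumB, horner, Matrix.cons_val, Fin.reduceFinMk]
    field_simp
    ring

theorem hasDerivAt_neg_S {x : ℂ} (h : IsTameAt x) :
    HasDerivAt (fun x => -S x) (hornerDeriv polyB x / (2 * -S x)) x := by
  refine (hasDerivAt_S h.2.2.2.1).neg.congr_deriv ?_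
  rw [mul_neg, div_neg]

theorem hasDerivAt_Y2_neg {x : ℂ} (h : IsTameAt x) :
    HasDerivAt Y2 (-x / (2 * -S x) * Y2 x) x :=
  (hasDerivAt_Y2 h).congr_deriv (by rw [mul_neg, neg_div_neg_eq])

theorem hasDerivAt_algJet (i : Fin 3) {x : ℂ} (h : IsTameAt x) {k : ℕ} (hk : k < 3) :
    HasDerivAt (algJet k i) (algJet (k + 1) i x) x := by
  fin_cases i
  · exact hasDerivAt_linNum h.1.1 h.1.2.2.2
      (hasDerivAt_div_sqrt_P3 (c := 1) h.2.1 (hasDerivAt_Y0 h)) hk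
  · exact hasDerivAt_radNum h.1.1 h.S_ne_zero (S_sq x) (hasDerivAt_S h.2.2.2.1)
      (hasDerivAt_div_sqrt_P3 (c := 1 / (2 * s7)) h.2.1 (hasDerivAt_Y1 h)) hk
  · exact hasDerivAt_radNum (s := fun x => -S x) h.1.1 (neg_ne_zero.2 h.S_ne_zero)
      (by rw [neg_sq, S_sq]) (hasDerivAt_neg_S h)
      (hasDerivAt_div_sqrt_P3 (c := -1 / (2 * s7)) h.2.1 (hasDerivAt_Y2_neg h)) hk

theorem differentiableAt_algSol (i : Fin 3) {x : ℂ} (h : IsTameAt x) :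
    DifferentiableAt ℂ (algSol i) x :=
  algSol_eq_algJet i ▸ (hasDerivAt_algJet i h (k := 0) (by norm_num)).differentiableAt

theorem hypEqAt_algSol (i : Fin 3) {V : Set ℂ} (hVo : IsOpen V) (hV : ∀ x ∈ V, IsTameAt x)
    (hV0 : ∀ x ∈ V, x ≠ 0) {x : ℂ} (hx : x ∈ V) :
    HypEqAt (-1 / 14) (3 / 14) (5 / 14) (1 / 3) (2 / 3) Psi3 (algSol i) x := by
  have hreg := fun y hy => (hV y hy).isRegularAt (hV0 y hy)
  rw [algSol_eq_algJet]
  fin_cases i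
  · exact hypEqAt_lin hVo hreg (fun y hy => hasDerivAt_div_sqrt_P3 (c := 1)
      (hV y hy).2.1 (hasDerivAt_Y0 (hV y hy))) hx
  · exact hypEqAt_rad hVo hreg (fun y _ => S_sq y) (fun y hy => hasDerivAt_S (hV y hy).2.2.2.1)
      (fun y hy => hasDerivAt_div_sqrt_P3 (c := 1 / (2 * s7))
        (hV y hy).2.1 (hasDerivAt_Y1 (hV y hy))) hx
  · exact hypEqAt_rad hVo hreg (s := fun x => -S x) (fun y _ => by rw [neg_sq, S_sq])
      (fun y hy => hasDerivAt_neg_S (hV y hy))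
      (fun y hy => hasDerivAt_div_sqrt_P3 (c := -1 / (2 * s7))
        (hV y hy).2.1 (hasDerivAt_Y2_neg (hV y hy))) hx

theorem algSol_jet (i : Fin 3) : algSol i 0 = algJet 0 i 0 ∧ deriv (algSol i) 0 = algJet 1 i 0 ∧
    deriv (deriv (algSol i)) 0 = algJet 2 i 0 := by
  have e : deriv (algSol i) =ᶠ[𝓝 0] algJet 1 i := eventually_isTameAt.mono fun y hy => by
    rw [algSol_eq_algJet, (hasDerivAt_algJet i hy (k := 0) (by norm_num)).deriv]
  refine ⟨by rw [algSol_eq_algJet], e.eq_of_nhds, ?_⟩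
  rw [e.deriv_eq, (hasDerivAt_algJet i isTameAt_zero (k := 1) (by norm_num)).deriv]

theorem algSol_zero_jet : algSol 0 0 = 0 ∧ deriv (algSol 0) 0 = 1 ∧
    deriv (deriv (algSol 0)) 0 = 1 / 3 := by
  have hY : Y0 0 / P3 0 ^ (1 / 2 : ℂ) = 1 := by norm_num [Y0, P3]
  obtain ⟨h0, h1, h2⟩ := algSol_jet 0
  rw [h0, h1, h2]
  simp only [algJet, Matrix.cons_val, hY]
  norm_num [linNum, horner, polyT, polyP]

theorem algSol_one_jet : algSol 1 0 = 1 ∧ deriv (algSol 1) 0 = (s7 - 3) / (2 * s7) ∧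
    deriv (deriv (algSol 1)) 0 = 0 := by
  have hs := s7_ne_zero
  have hY : Y1 0 / P3 0 ^ (1 / 2 : ℂ) = 1 := by
    norm_num [Y1, P3, S_zero, div_self add_s7_ne_zero]
  obtain ⟨h0, h1, h2⟩ := algSol_jet 1
  rw [h0, h1, h2]
  simp only [algJet, Matrix.cons_val, hY, S_zero]
  refine ⟨?_, ?_, ?_⟩
  · norm_num [radNumA, radNumB, horner]; field_simp
  · norm_num [radNumA, radNumB, horner, polyB, polyP]; field_simp; ring
  · norm_num [radNumA, radNumB, horner, polyB, polyP]

theorem algSol_two_jet : algSol 2 0 = 1 ∧ deriv (algSol 2) 0 = (s7 + 3) / (2 * s7) ∧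
    deriv (deriv (algSol 2)) 0 = 0 := by
  have hs := s7_ne_zero
  have hY : Y2 0 / P3 0 ^ (1 / 2 : ℂ) = 1 := by
    norm_num [Y2, P3, S_zero, div_self sub_s7_ne_zero]
  obtain ⟨h0, h1, h2⟩ := algSol_jet 2
  rw [h0, h1, h2]
  simp only [algJet, Matrix.cons_val, hY, S_zero]
  refine ⟨?_, ?_, ?_⟩
  · norm_num [radNumA, radNumB, horner]; field_simp
  · norm_num [radNumA, radNumB, horner, polyB, polyP]; field_simp; ring
  · norm_num [radNumA, radNumB, horner, polyB, polyP]

theorem wronskian3_algSol_zero : wronskian3 (algSol 0) (algSol 1) (algSol 2) 0 = 1 / s7 := by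
  obtain ⟨a0, a1, a2⟩ := algSol_zero_jet
  obtain ⟨b0, b1, b2⟩ := algSol_one_jet
  obtain ⟨c0, c1, c2⟩ := algSol_two_jet
  have := s7_ne_zero
  rw [wronskian3, a0, a1, a2, b0, b1, b2, c0, c1, c2]
  field_simp
  ring

/-! ### The solution space near x = 0 -/

/-- The leading coefficient P³TB has no zero on V, so the normalized coefficients stay finite even
at x = 0; only the translation from the hypergeometric form excludes that point. -/
theorem hypEqAt_iff_thirdOrderEqAt {V : Set ℂ} (hVo : IsOpen V) (hV : ∀ x ∈ V, IsTameAt x)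
    {u : ℂ → ℂ} (hu : DifferentiableOn ℂ u V) {x : ℂ} (hx : x ∈ V) (hx0 : x ≠ 0) :
    HypEqAt (-1 / 14) (3 / 14) (5 / 14) (1 / 3) (2 / 3) Psi3 u x ↔
      ThirdOrderEqAt
        (fun x => -(horner polyODE2 x / (horner polyP x * horner polyT x * horner polyB x)))
        (fun x => -(horner polyODE1 x / (horner polyP x ^ 2 * horner polyT x * horner polyB x)))
        (fun x => -(horner polyODE0 x / (horner polyP x ^ 3 * horner polyT x * horner polyB x)))
        u x := by
  have hV'o : IsOpen (V \ {0}) := hVo.sdiff isClosed_singleton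
  have hu' : DifferentiableOn ℂ u (V \ {0}) := hu.mono Set.sdiff_subset
  have hd : ∀ {f : ℂ → ℂ}, DifferentiableOn ℂ f (V \ {0}) →
      ∀ y ∈ V \ {0}, HasDerivAt f (deriv f y) y := fun hf y hy =>
    (hf.differentiableAt (hV'o.mem_nhds hy)).hasDerivAt
  rw [hypEqAt_iff_ode hV'o (fun y hy => (hV y hy.1).isRegularAt hy.2) (hd hu')
    (hd (hu'.deriv hV'o)) (hd ((hu'.deriv hV'o).deriv hV'o)) ⟨hx, hx0⟩, ThirdOrderEqAt]
  obtain ⟨h1, h2, h3, h4, h5, h6⟩ := (hV x hx).isRegularAt hx0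
  constructor
  · intro h
    field_simp
    linear_combination h
  · intro h
    field_simp at h
    linear_combination h

/-- On a connected open set near `0` every solution is a combination of the algebraic ones. -/
theorem exists_eq_algSol_combination {U : Set ℂ} (hU : IsOpen U) (hc : IsPreconnected U)
    (ht : ∀ x ∈ U, IsTameAt x)
    (hW : ∀ x ∈ U, wronskian3 (algSol 0) (algSol 1) (algSol 2) x ≠ 0)
    {u : ℂ → ℂ} (hu : DifferentiableOn ℂ u U)
    (he : ∀ x ∈ U, x ≠ 0 → HypEqAt (-1 / 14) (3 / 14) (5 / 14) (1 / 3) (2 / 3) Psi3 u x) :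
    ∃ c₀ c₁ c₂ : ℂ, ∀ x ∈ U, u x = c₀ * algSol 0 x + c₁ * algSol 1 x + c₂ * algSol 2 x := by
  have hd : ∀ i, DifferentiableOn ℂ (algSol i) U := fun i x hx =>
    (differentiableAt_algSol i (ht x hx)).differentiableWithinAt
  have ha : ∀ i, ∀ x ∈ U, x ≠ 0 → ThirdOrderEqAt _ _ _ (algSol i) x := fun i x hx h0 =>
    (hypEqAt_iff_thirdOrderEqAt hU ht (hd i) hx h0).1 (hypEqAt_algSol i
      (V := U \ {0}) (hU.sdiff isClosed_singleton) (fun y hy => ht y hy.1) (fun y hy => hy.2)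
      ⟨hx, h0⟩)
  exact exists_linear_combination_of_thirdOrderEqAt hU hc hu (hd 0) (hd 1) (hd 2) hW
    (fun x hx h0 => (hypEqAt_iff_thirdOrderEqAt hU ht hu hx h0).1 (he x hx h0))
    (ha 0) (ha 1) (ha 2)

/-- Linearity is immediate in the explicit third-order form, so the equation is passed there and
back. -/
theorem hypEqAt_algSol_combination {U : Set ℂ} (hU : IsOpen U) (ht : ∀ x ∈ U, IsTameAt x)
    {u : ℂ → ℂ} {c₀ c₁ c₂ : ℂ}
    (h : ∀ x ∈ U, u x = c₀ * algSol 0 x + c₁ * algSol 1 x + c₂ * algSol 2 x) {x : ℂ} (hx : x ∈ U)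
    (h0 : x ≠ 0) : HypEqAt (-1 / 14) (3 / 14) (5 / 14) (1 / 3) (2 / 3) Psi3 u x := by
  have hd : ∀ i, DifferentiableOn ℂ (algSol i) U := fun i x hx =>
    (differentiableAt_algSol i (ht x hx)).differentiableWithinAt
  have ha : ∀ i, ThirdOrderEqAt _ _ _ (algSol i) x := fun i =>
    (hypEqAt_iff_thirdOrderEqAt hU ht (hd i) hx h0).1 (hypEqAt_algSol i
      (V := U \ {0}) (hU.sdiff isClosed_singleton) (fun y hy => ht y hy.1) (fun y hy => hy.2)
      ⟨hx, h0⟩)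
  have hu : DifferentiableOn ℂ u U :=
    (((hd 0).const_mul c₀).add ((hd 1).const_mul c₁) |>.add ((hd 2).const_mul c₂)).congr h
  exact (hypEqAt_iff_thirdOrderEqAt hU ht hu hx h0).2
    (ThirdOrderEqAt.linear_combination hU (hd 0) (hd 1) (hd 2) h hx (ha 0) (ha 1) (ha 2))

/-- Some combination represents u. Its coefficients differ from the prescribed ones by a combination
with zero 2-jet at 0, which is trivial because the Wronskian does not vanish there. -/
theorem eq_algSol_combination_of_jet {U : Set ℂ} (hU : IsOpen U) (hc : IsPreconnected U)
    (hU0 : (0 : ℂ) ∈ U) (ht : ∀ x ∈ U, IsTameAt x)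
    (hW : ∀ x ∈ U, wronskian3 (algSol 0) (algSol 1) (algSol 2) x ≠ 0)
    {u : ℂ → ℂ} (hu : DifferentiableOn ℂ u U)
    (he : ∀ x ∈ U, x ≠ 0 → HypEqAt (-1 / 14) (3 / 14) (5 / 14) (1 / 3) (2 / 3) Psi3 u x)
    {c₀ c₁ c₂ : ℂ} (h0 : u 0 = c₁ + c₂)
    (h1 : deriv u 0 = c₀ + c₁ * ((s7 - 3) / (2 * s7)) + c₂ * ((s7 + 3) / (2 * s7)))
    (h2 : deriv (deriv u) 0 = c₀ / 3) :
    ∀ x ∈ U, u x = c₀ * algSol 0 x + c₁ * algSol 1 x + c₂ * algSol 2 x := by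
  obtain ⟨d₀, d₁, d₂, hd⟩ := exists_eq_algSol_combination hU hc ht hW hu he
  have dd : ∀ i, DifferentiableOn ℂ (algSol i) U := fun i x hx =>
    (differentiableAt_algSol i (ht x hx)).differentiableWithinAt
  have e1 := deriv_linear_combination_eqOn hU (dd 0) (dd 1) (dd 2) hd
  have e2 := deriv_linear_combination_eqOn hU ((dd 0).deriv hU) ((dd 1).deriv hU)
    ((dd 2).deriv hU) e1
  have k0 := hd 0 hU0
  have k1 := e1 0 hU0
  have k2 := e2 0 hU0
  obtain ⟨a0, a1, a2⟩ := algSol_zero_jet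
  obtain ⟨b0, b1, b2⟩ := algSol_one_jet
  obtain ⟨g0, g1, g2⟩ := algSol_two_jet
  obtain ⟨z0, z1, z2⟩ := eq_zero_of_wronskian3_ne_zero (hW 0 hU0)
    (c₀ := d₀ - c₀) (c₁ := d₁ - c₁) (c₂ := d₂ - c₂)
    (by rw [h0, a0, b0, g0] at k0; rw [a0, b0, g0]; linear_combination -k0)
    (by rw [h1, a1, b1, g1] at k1; rw [a1, b1, g1]; linear_combination -k1)
    (by rw [h2, a2, b2, g2] at k2; rw [a2, b2, g2]; linear_combination -k2)
  intro x hx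
  rw [hd x hx, sub_eq_zero.1 z0, sub_eq_zero.1 z1, sub_eq_zero.1 z2]

/-! ### The hypergeometric solutions -/

theorem deriv_mul_eqOn {U : Set ℂ} (hU : IsOpen U) {a b : ℂ → ℂ} (ha : DifferentiableOn ℂ a U)
    (hb : DifferentiableOn ℂ b U) :
    ∀ x ∈ U, deriv (fun y => a y * b y) x = deriv a x * b x + a x * deriv b x := fun _ hx =>
  ((ha.differentiableAt (hU.mem_nhds hx)).hasDerivAt.mul
    (hb.differentiableAt (hU.mem_nhds hx)).hasDerivAt).deriv

theorem deriv_deriv_mul {U : Set ℂ} (hU : IsOpen U) {a b : ℂ → ℂ} (ha : DifferentiableOn ℂ a U)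
    (hb : DifferentiableOn ℂ b U) {x : ℂ} (hx : x ∈ U) :
    deriv (deriv (fun y => a y * b y)) x =
      deriv (deriv a) x * b x + 2 * deriv a x * deriv b x + a x * deriv (deriv b) x := by
  have hd : ∀ {f : ℂ → ℂ}, DifferentiableOn ℂ f U → HasDerivAt f (deriv f x) x := fun hf =>
    (hf.differentiableAt (hU.mem_nhds hx)).hasDerivAt
  have e : deriv (fun y => a y * b y) =ᶠ[𝓝 x] fun x => deriv a x * b x + a x * deriv b x := by
    filter_upwards [hU.mem_nhds hx] with y hy using deriv_mul_eqOn hU ha hb y hy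
  rw [e.deriv_eq]
  refine (((hd (ha.deriv hU)).mul (hd hb)).add ((hd ha).mul (hd (hb.deriv hU)))).deriv.trans ?_
  ring

theorem Psi3_zero : Psi3 0 = 0 := by simp [Psi3]

theorem deriv_Psi3_zero : deriv Psi3 0 = 0 := by
  rw [(hasDerivAt_Psi3 isTameAt_zero.1.1).deriv]; simp

theorem differentiableOn_hyp32 {a₁ a₂ a₃ b₁ b₂ : ℂ} (hb : ∀ n, ‖hyp32Coeff a₁ a₂ a₃ b₁ b₂ n‖ ≤ 1) :
    DifferentiableOn ℂ (hyp32 a₁ a₂ a₃ b₁ b₂) (Metric.ball 0 1) := fun z hz =>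
  (hasDerivAt_tsum_of_poly_bound (C := 1) (k := 0) (by simpa using hb)
    (by simpa using hz)).differentiableAt.differentiableWithinAt

theorem hyp32_zero (a₁ a₂ a₃ b₁ b₂ : ℂ) : hyp32 a₁ a₂ a₃ b₁ b₂ 0 = 1 := by
  rw [hyp32, tsum_eq_single 0 (fun n hn => by simp [hn])]
  simp [hyp32Coeff]

/-- As `Ψ₃` vanishes to third order at `0`, composition with it kills the first two derivatives. -/
theorem comp_Psi3_jet {F : ℂ → ℂ} (hF : DifferentiableOn ℂ F (Metric.ball 0 1)) :
    deriv (fun x => F (Psi3 x)) 0 = 0 ∧ deriv (deriv (fun x => F (Psi3 x))) 0 = 0 := by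
  have hΨ : ContinuousAt Psi3 0 := (hasDerivAt_Psi3 isTameAt_zero.1.1).continuousAt
  have hmem : ∀ᶠ x in 𝓝 (0 : ℂ), Psi3 x ∈ Metric.ball (0 : ℂ) 1 :=
    hΨ.eventually_mem (Metric.isOpen_ball.mem_nhds (by simp [Psi3_zero]))
  have e : deriv (fun x => F (Psi3 x)) =ᶠ[𝓝 0] fun x => x ^ 2 * (deriv F (Psi3 x) *
      (49 * horner polyA x ^ 2 * horner polyR x / (1728 * horner polyP x ^ 8))) := by
    filter_upwards [hmem, eventually_isTameAt] with x hx ht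
    have h := ((hF.differentiableAt (Metric.isOpen_ball.mem_nhds hx)).hasDerivAt.comp x
      (hasDerivAt_Psi3 ht.1.1)).deriv
    exact h.trans (by ring)
  refine ⟨by rw [e.eq_of_nhds]; simp, ?_⟩
  rw [e.deriv_eq]
  have hp := isTameAt_zero.1.1
  have d1 : DifferentiableAt ℂ (fun x => deriv F (Psi3 x)) 0 :=
    ((hF.deriv Metric.isOpen_ball).differentiableAt
      (Metric.isOpen_ball.mem_nhds (by simp [Psi3_zero]))).comp 0
      (hasDerivAt_Psi3 hp).differentiableAt
  have hl : ∀ l x, DifferentiableAt ℂ (horner l) x := fun l x => (hasDerivAt_horner l x).differentiableAt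
  have d2 : DifferentiableAt ℂ (fun x => 49 * horner polyA x ^ 2 * horner polyR x /
      (1728 * horner polyP x ^ 8)) 0 :=
    ((((hl polyA 0).pow 2).const_mul 49).mul (hl polyR 0)).div (((hl polyP 0).pow 8).const_mul 1728)
      (by simpa using hp)
  refine ((hasDerivAt_pow 2 (0 : ℂ)).mul (d1.mul d2).hasDerivAt).deriv.trans ?_
  simp

/-- The factor of exponent `1/3`, a constant multiple of a cube root of `Ψ₃`. -/
noncomputable def cubeRootFactor (x : ℂ) : ℂ := x * (Q3 x * P3 x ^ (-7 / 3 : ℂ))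

theorem hasDerivAt_Q3_mul_P3_cpow {x : ℂ} (h : IsTameAt x) :
    HasDerivAt (fun x => Q3 x * P3 x ^ (-7 / 3 : ℂ))
      (-(hornerDeriv polyA x / 1372) * P3 x ^ (-7 / 3 : ℂ) +
        Q3 x * (-7 / 3 * hornerDeriv polyP x / horner polyP x * P3 x ^ (-7 / 3 : ℂ))) x :=
  (hasDerivAt_Q3 x).mul (hasDerivAt_P3_cpow h.2.1 _)

/-- Q₃ is a multiple of A, so the cube of this function is a constant times Ψ₃ and its logarithmic
derivative is one third of Ψ'/Ψ = 49R/N. The point 0 is excluded because N vanishes there. -/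
theorem hasDerivAt_cubeRootFactor {x : ℂ} (h : IsTameAt x) (hx : x ≠ 0) :
    HasDerivAt cubeRootFactor (49 * horner polyR x / (3 * horner polyN x) * cubeRootFactor x) x := by
  refine ((hasDerivAt_id x).mul (hasDerivAt_Q3_mul_P3_cpow h)).congr_deriv ?_
  have hp := h.1.1
  have hA := h.1.2.1
  rw [cubeRootFactor, polyN_eq, Q3_eq, id]
  generalize P3 x ^ (-7 / 3 : ℂ) = c
  field_simp
  linear_combination -c * deriv_identity x

theorem cubeRootFactor_jet : cubeRootFactor 0 = 0 ∧ deriv cubeRootFactor 0 = 1 ∧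
    deriv (deriv cubeRootFactor) 0 = 1 / 6 := by
  have hd : HasDerivAt (fun x => Q3 x * P3 x ^ (-7 / 3 : ℂ)) (1 / 12) 0 := by
    refine (hasDerivAt_Q3_mul_P3_cpow isTameAt_zero).congr_deriv ?_
    norm_num [P3, Q3, polyA, polyP, horner, hornerDeriv]
  obtain ⟨U, hUs, hUo, hU0⟩ := eventually_nhds_iff.1 eventually_isTameAt
  have hq : DifferentiableOn ℂ (fun x => Q3 x * P3 x ^ (-7 / 3 : ℂ)) U := fun x hx =>
    (hasDerivAt_Q3_mul_P3_cpow (hUs x hx)).differentiableAt.differentiableWithinAt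
  have e : cubeRootFactor = fun x => id x * (Q3 x * P3 x ^ (-7 / 3 : ℂ)) := rfl
  have did : deriv (id : ℂ → ℂ) = fun _ => 1 := funext fun x => deriv_id x
  refine ⟨by simp [cubeRootFactor], ?_, ?_⟩
  · rw [e, deriv_mul_eqOn hUo differentiableOn_id hq 0 hU0, did]
    norm_num [P3, Q3]
  · rw [e, deriv_deriv_mul hUo differentiableOn_id hq hU0, did, hd.deriv]
    norm_num

theorem isEulerOn_cubeRootFactor {V : Set ℂ} (hV : ∀ x ∈ V, IsTameAt x) (hV0 : ∀ x ∈ V, x ≠ 0) :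
    IsEulerOn Psi3 V cubeRootFactor (fun x => 1 / 3 * cubeRootFactor x) := by
  have hreg := fun x hx => (hV x hx).isRegularAt (hV0 x hx)
  intro x hx
  obtain ⟨h1, h2⟩ := isEulerOn_Psi3 hreg
    (fun x hx => hasDerivAt_cubeRootFactor (hV x hx) (hV0 x hx)) x hx
  refine ⟨h1, h2.trans ?_⟩
  obtain ⟨k1, k2, k3, k4, -⟩ := hreg x hx
  simp only [polyN_eq]
  field_simp

theorem isEulerOn_cubeRootFactor_sq {V : Set ℂ} (hV : ∀ x ∈ V, IsTameAt x)
    (hV0 : ∀ x ∈ V, x ≠ 0) :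
    IsEulerOn Psi3 V (fun x => cubeRootFactor x * cubeRootFactor x)
      (fun x => 2 / 3 * (cubeRootFactor x * cubeRootFactor x)) := by
  have hreg := fun x hx => (hV x hx).isRegularAt (hV0 x hx)
  intro x hx
  obtain ⟨h1, h2⟩ := isEulerOn_Psi3 hreg
    (fun x hx => (hasDerivAt_cubeRootFactor (hV x hx) (hV0 x hx)).mul
      (hasDerivAt_cubeRootFactor (hV x hx) (hV0 x hx))) x hx
  refine ⟨h1, h2.trans ?_⟩
  obtain ⟨k1, k2, k3, k4, -⟩ := hreg x hx
  simp only [polyN_eq]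
  field_simp
  ring

theorem norm_hyp32Coeff_first (n : ℕ) :
    ‖hyp32Coeff (-1 / 14) (3 / 14) (5 / 14) (1 / 3) (2 / 3) n‖ ≤ 1 := by
  have := norm_hyp32Coeff_le_one (a₁ := -1 / 14) (a₂ := 3 / 14) (a₃ := 5 / 14) (b₁ := 1 / 3)
    (b₂ := 2 / 3) (by norm_num [abs_le]) (by norm_num [abs_le]) (by norm_num [abs_le])
    (by norm_num) (by norm_num) n
  push_cast at this
  exact this

theorem norm_hyp32Coeff_second (n : ℕ) :
    ‖hyp32Coeff (11 / 42) (23 / 42) (29 / 42) (2 / 3) (4 / 3) n‖ ≤ 1 := by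
  have := norm_hyp32Coeff_le_one (a₁ := 11 / 42) (a₂ := 23 / 42) (a₃ := 29 / 42) (b₁ := 2 / 3)
    (b₂ := 4 / 3) (by norm_num [abs_le]) (by norm_num [abs_le]) (by norm_num [abs_le])
    (by norm_num) (by norm_num) n
  push_cast at this
  exact this

theorem norm_hyp32Coeff_third (n : ℕ) :
    ‖hyp32Coeff (25 / 42) (37 / 42) (43 / 42) (4 / 3) (5 / 3) n‖ ≤ 1 := by
  -- The upper parameter 43/42 exceeds 1, so it must be paired with a lower parameter and not with
  -- the 1 of n!.
  have := norm_hyp32Coeff_le_one (a₁ := 25 / 42) (a₂ := 37 / 42) (a₃ := 43 / 42) (b₁ := 4 / 3)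
    (b₂ := 5 / 3) (by norm_num [abs_le]) (by norm_num [abs_le]) (by norm_num [abs_le])
    (by norm_num) (by norm_num) n
  push_cast at this
  exact this

theorem ofReal_add_natCast_ne_zero {b : ℝ} (hb : 0 < b) (n : ℕ) : (b : ℂ) + n ≠ 0 := by
  exact_mod_cast (by positivity : b + n ≠ 0)

/-- Identification of a hypergeometric solution from its `2`-jet. -/
theorem mul_hyp32_eq_algSol_combination {U : Set ℂ} (hU : IsOpen U) (hc : IsPreconnected U)
    (hU0 : (0 : ℂ) ∈ U) (ht : ∀ x ∈ U, IsTameAt x)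
    (hW : ∀ x ∈ U, wronskian3 (algSol 0) (algSol 1) (algSol 2) x ≠ 0)
    (hΨ : ∀ x ∈ U, ‖Psi3 x‖ < 1) {A₁ A₂ A₃ B₁ B₂ e : ℂ} {g : ℂ → ℂ}
    (hA₁ : -1 / 14 + e = A₁) (hA₂ : 3 / 14 + e = A₂) (hA₃ : 5 / 14 + e = A₃)
    (hb : ∀ n, ‖hyp32Coeff A₁ A₂ A₃ B₁ B₂ n‖ ≤ 1)
    (hB₁ : ∀ n : ℕ, B₁ + n ≠ 0) (hB₂ : ∀ n : ℕ, B₂ + n ≠ 0)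
    (hind : ∀ t : ℂ, (t + e) * (t + e + (1 / 3 - 1)) * (t + e + (2 / 3 - 1)) =
      t * (t + (B₁ - 1)) * (t + (B₂ - 1)))
    (hg : DifferentiableOn ℂ g U) (hgE : IsEulerOn Psi3 (U \ {0}) g (fun x => e * g x))
    {c₀ c₁ c₂ : ℂ} (h0 : g 0 = c₁ + c₂)
    (h1 : deriv g 0 = c₀ + c₁ * ((s7 - 3) / (2 * s7)) + c₂ * ((s7 + 3) / (2 * s7)))
    (h2 : deriv (deriv g) 0 = c₀ / 3) :
    ∀ x ∈ U, g x * hyp32 A₁ A₂ A₃ B₁ B₂ (Psi3 x) =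
      c₀ * algSol 0 x + c₁ * algSol 1 x + c₂ * algSol 2 x := by
  have hF := differentiableOn_hyp32 hb
  have hv : DifferentiableOn ℂ (fun x => hyp32 A₁ A₂ A₃ B₁ B₂ (Psi3 x)) U :=
    hF.comp (fun x hx => (hasDerivAt_Psi3 (ht x hx).1.1).differentiableAt.differentiableWithinAt)
      (fun x hx => by simpa using hΨ x hx)
  obtain ⟨v1, v2⟩ := comp_Psi3_jet hF
  have v0 : hyp32 A₁ A₂ A₃ B₁ B₂ (Psi3 0) = 1 := by rw [Psi3_zero, hyp32_zero]
  refine eq_algSol_combination_of_jet hU hc hU0 ht hW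
    (u := fun x => g x * hyp32 A₁ A₂ A₃ B₁ B₂ (Psi3 x)) (hg.mul hv) ?_ ?_ ?_ ?_
  · intro x hx hx0
    subst hA₁ hA₂ hA₃
    exact hypEqAt_mul_hyp32 (V := U \ {0}) (hU.sdiff isClosed_singleton)
      (fun y hy => (hasDerivAt_Psi3 (ht y hy.1).1.1).differentiableAt)
      (fun y hy => ((ht y hy.1).isRegularAt hy.2).deriv_Psi3_ne_zero)
      (fun y hy => ((ht y hy.1).isRegularAt hy.2).Psi3_ne_zero) (fun y hy => hΨ y hy.1)
      hgE hb hB₁ hB₂ hind ⟨hx, hx0⟩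
  · rw [← h0, v0, mul_one]
  · rw [deriv_mul_eqOn hU hg hv 0 hU0, v1, v0, ← h1]; ring
  · rw [deriv_deriv_mul hU hg hv hU0, v2, v1, v0, ← h2]; ring

/-! ### The basis property and the three identities -/

theorem exists_ball_isTameAt : ∃ r : ℝ, 0 < r ∧ ∀ x ∈ Metric.ball (0 : ℂ) r, IsTameAt x ∧
    wronskian3 (algSol 0) (algSol 1) (algSol 2) x ≠ 0 ∧ ‖Psi3 x‖ < 1 := by
  obtain ⟨U, hUs, hUo, hU0⟩ := eventually_nhds_iff.1 eventually_isTameAt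
  have dd : ∀ i, DifferentiableOn ℂ (algSol i) U := fun i x hx =>
    (differentiableAt_algSol i (hUs x hx)).differentiableWithinAt
  have hW : ∀ᶠ x in 𝓝 (0 : ℂ), wronskian3 (algSol 0) (algSol 1) (algSol 2) x ≠ 0 := by
    refine ((differentiableOn_wronskian3 hUo (dd 0) (dd 1) (dd 2)).differentiableAt
      (hUo.mem_nhds hU0)).continuousAt.eventually_ne ?_
    rw [wronskian3_algSol_zero]
    exact one_div_ne_zero s7_ne_zero
  have hΨ : ∀ᶠ x in 𝓝 (0 : ℂ), ‖Psi3 x‖ < 1 :=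
    (hasDerivAt_Psi3 isTameAt_zero.1.1).continuousAt.norm.eventually_lt_const
      (by simp [Psi3_zero])
  exact Metric.eventually_nhds_iff_ball.1 (eventually_isTameAt.and (hW.and hΨ))

/-- On the disk √P₃ is holomorphic and nonvanishing, so multiplying by it carries the result for
Y/√P₃ to Y. There Ψ₃' vanishes only at x = 0, so the points excluded by the definition of a solution
are exactly those that the Wronskian argument can skip. -/
theorem isPullbackSolutionBasisNearZero_algebraic :
    IsPullbackSolutionBasisNearZero (-1 / 14) (3 / 14) (5 / 14) (1 / 3) (2 / 3)
      (fun x => P3 x ^ (1 / 2 : ℂ)) Psi3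
      ![fun x => x * Y0 x, fun x => W1 x * Y1 x, fun x => W2 x * Y2 x] := by
  obtain ⟨r, hr, H⟩ := exists_ball_isTameAt
  refine ⟨r, hr, fun U hU hc hUr => ?_⟩
  have ht : ∀ x ∈ U, IsTameAt x := fun x hx => (H x (hUr hx)).1
  have hθ : ∀ x ∈ U, P3 x ^ (1 / 2 : ℂ) ≠ 0 := fun x hx => by
    simp [Complex.cpow_eq_zero_iff, Complex.slitPlane_ne_zero (ht x hx).2.1]
  have hθd : DifferentiableOn ℂ (fun x => P3 x ^ (1 / 2 : ℂ)) U := fun x hx =>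
    (hasDerivAt_P3_cpow (ht x hx).2.1 _).differentiableAt.differentiableWithinAt
  have dd : ∀ i, DifferentiableOn ℂ (algSol i) U := fun i x hx =>
    (differentiableAt_algSol i (ht x hx)).differentiableWithinAt
  have hsum : ∀ c : Fin 3 → ℂ, ∀ x ∈ U,
      ∑ i, c i * (![fun x => x * Y0 x, fun x => W1 x * Y1 x, fun x => W2 x * Y2 x] :
        Fin 3 → ℂ → ℂ) i x =
      P3 x ^ (1 / 2 : ℂ) * (c 0 * algSol 0 x + c 1 * algSol 1 x + c 2 * algSol 2 x) := by
    intro c x hx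
    have := hθ x hx
    simp only [Fin.sum_univ_three, algSol, Matrix.cons_val]
    field_simp
  refine ⟨fun Y => ⟨fun hY => ?_, ?_⟩, fun c hc0 => ?_⟩
  · obtain ⟨c₀, c₁, c₂, h⟩ := exists_eq_algSol_combination hU hc.isPreconnected ht
      (fun x hx => (H x (hUr hx)).2.1) (hY.1.div hθd hθ) (fun x hx hx0 =>
        hY.2 x hx ((ht x hx).isRegularAt hx0).deriv_Psi3_ne_zero (hθ x hx))
    refine ⟨![c₀, c₁, c₂], fun x hx => ?_⟩
    rw [hsum _ x hx]
    have h' : Y x / P3 x ^ (1 / 2 : ℂ) = _ := h x hx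
    simp only [Matrix.cons_val]
    rw [← h', mul_div_cancel₀ _ (hθ x hx)]
  · rintro ⟨c, h⟩
    have h' : ∀ x ∈ U, Y x = P3 x ^ (1 / 2 : ℂ) *
        (c 0 * algSol 0 x + c 1 * algSol 1 x + c 2 * algSol 2 x) := fun x hx =>
      (h x hx).trans (hsum c x hx)
    refine ⟨(hθd.mul ((((dd 0).const_mul _).add ((dd 1).const_mul _)).add
      ((dd 2).const_mul _))).congr h', fun x hx hφ _ => ?_⟩
    refine hypEqAt_algSol_combination hU ht (c₀ := c 0) (c₁ := c 1) (c₂ := c 2)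
      (fun y hy => ?_) hx (fun h0 => hφ (by rw [h0, deriv_Psi3_zero]))
    rw [h' y hy, mul_div_cancel_left₀ _ (hθ y hy)]
  · obtain ⟨x, hx⟩ := hc.nonempty
    obtain ⟨z0, z1, z2⟩ := eq_zero_of_linear_combination_eq_zero hU (dd 0) (dd 1) (dd 2)
      (fun y hy => (mul_eq_zero.1 ((hsum c y hy).symm.trans (hc0 y hy))).resolve_left (hθ y hy))
      hx (H x (hUr hx)).2.1
    funext i
    fin_cases i <;> assumption

theorem cpow_half_mul_cpow {z : ℂ} (hz : z ≠ 0) {a b : ℂ} (h : 1 / 2 + a = b) :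
    z ^ (1 / 2 : ℂ) * z ^ a = z ^ b := by
  rw [← Complex.cpow_add _ _ hz, h]

theorem hypergeometric_identities : ∀ᶠ x in 𝓝 (0 : ℂ),
    P3 x ^ (1 / 2 : ℂ) * hyp32 (-1 / 14) (3 / 14) (5 / 14) (1 / 3) (2 / 3) (Psi3 x) =
      (3 + s7) / 6 * (W1 x * Y1 x) + (3 - s7) / 6 * (W2 x * Y2 x) ∧
    x * Q3 x * P3 x ^ (-11 / 6 : ℂ) *
        hyp32 (11 / 42) (23 / 42) (29 / 42) (2 / 3) (4 / 3) (Psi3 x) =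
      1 / 2 * (x * Y0 x) - s7 / 6 * (W1 x * Y1 x) + s7 / 6 * (W2 x * Y2 x) ∧
    x ^ 2 * Q3 x ^ 2 * P3 x ^ (-25 / 6 : ℂ) *
        hyp32 (25 / 42) (37 / 42) (43 / 42) (4 / 3) (5 / 3) (Psi3 x) =
      6 * (x * Y0 x) + 2 * s7 * (W1 x * Y1 x) - 2 * s7 * (W2 x * Y2 x) := by
  obtain ⟨r, hr, H⟩ := exists_ball_isTameAt
  have hU0 : (0 : ℂ) ∈ Metric.ball (0 : ℂ) r := Metric.mem_ball_self hr
  have hc : IsPreconnected (Metric.ball (0 : ℂ) r) := (convex_ball 0 r).isPreconnected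
  have hU : IsOpen (Metric.ball (0 : ℂ) r) := Metric.isOpen_ball
  set U := Metric.ball (0 : ℂ) r
  have ht : ∀ x ∈ U, IsTameAt x := fun x hx => (H x hx).1
  have hs := s7_ne_zero
  have hs2 := s7_sq
  have hpos : ∀ b : ℝ, 0 < b → ∀ n : ℕ, (b : ℂ) + n ≠ 0 := fun b hb n =>
    ofReal_add_natCast_ne_zero hb n
  have p13 : ∀ n : ℕ, (1 / 3 : ℂ) + n ≠ 0 := by simpa using hpos (1 / 3) (by norm_num)
  have p23 : ∀ n : ℕ, (2 / 3 : ℂ) + n ≠ 0 := by simpa using hpos (2 / 3) (by norm_num)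
  have p43 : ∀ n : ℕ, (4 / 3 : ℂ) + n ≠ 0 := by simpa using hpos (4 / 3) (by norm_num)
  have p53 : ∀ n : ℕ, (5 / 3 : ℂ) + n ≠ 0 := by simpa using hpos (5 / 3) (by norm_num)
  have hg : DifferentiableOn ℂ cubeRootFactor U := fun x hx =>
    (differentiableAt_id.mul
      (hasDerivAt_Q3_mul_P3_cpow (ht x hx)).differentiableAt).differentiableWithinAt
  obtain ⟨g0, g1, g2⟩ := cubeRootFactor_jet
  have one0 : deriv (fun _ : ℂ => (1 : ℂ)) = fun _ => 0 := deriv_const' 1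
  -- The algebraic solutions have value, first and second derivative (0, 1, 1/3), (1, (√7-3)/(2√7),
  -- 0), (1, (√7+3)/(2√7), 0) at 0. The coefficients solve the linear system for (1, 0, 0) here,
  -- then for (0, 1, 1/6) and (0, 0, 2).
  have I₁ := mul_hyp32_eq_algSol_combination hU hc hU0 ht (fun x hx => (H x hx).2.1)
    (fun x hx => (H x hx).2.2) (e := 0) (g := fun _ => 1) (c₀ := 0) (c₁ := (3 + s7) / 6)
    (c₂ := (3 - s7) / 6) (add_zero _) (add_zero _) (add_zero _) norm_hyp32Coeff_first p13 p23
    (fun t => by ring) (differentiableOn_const 1) (fun x _ => ⟨differentiableAt_const 1, by simp⟩)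
    (by ring) (by rw [one0]; field_simp; ring) (by rw [one0, deriv_const]; ring)
  have I₂ := mul_hyp32_eq_algSol_combination hU hc hU0 ht (fun x hx => (H x hx).2.1)
    (fun x hx => (H x hx).2.2) (e := 1 / 3) (A₁ := 11 / 42) (A₂ := 23 / 42) (A₃ := 29 / 42)
    (g := cubeRootFactor) (c₀ := 1 / 2) (c₁ := -s7 / 6) (c₂ := s7 / 6)
    (by norm_num) (by norm_num) (by norm_num) norm_hyp32Coeff_second p23 p43
    (fun t => by ring) hg
    (isEulerOn_cubeRootFactor (fun x hx => ht x hx.1) (fun x hx => hx.2))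
    (by rw [g0]; ring) (by rw [g1]; field_simp; ring) (by rw [g2]; norm_num)
  have I₃ := mul_hyp32_eq_algSol_combination hU hc hU0 ht (fun x hx => (H x hx).2.1)
    (fun x hx => (H x hx).2.2) (e := 2 / 3) (A₁ := 25 / 42) (A₂ := 37 / 42) (A₃ := 43 / 42)
    (g := fun x => cubeRootFactor x * cubeRootFactor x) (c₀ := 6) (c₁ := 2 * s7) (c₂ := -(2 * s7))
    (by norm_num) (by norm_num) (by norm_num) norm_hyp32Coeff_third p43 p53
    (fun t => by ring) (hg.mul hg)
    (isEulerOn_cubeRootFactor_sq (fun x hx => ht x hx.1) (fun x hx => hx.2))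
    (by rw [g0]; ring)
    (by rw [deriv_mul_eqOn hU hg hg 0 hU0, g0]; field_simp; ring)
    (by rw [deriv_deriv_mul hU hg hg hU0, g0, g1]; norm_num)
  filter_upwards [hU.mem_nhds hU0] with x hx
  have hP : P3 x ≠ 0 := Complex.slitPlane_ne_zero (ht x hx).2.1
  have hθ : P3 x ^ (1 / 2 : ℂ) ≠ 0 := by simp [Complex.cpow_eq_zero_iff, hP]
  have a0 : x * Y0 x = P3 x ^ (1 / 2 : ℂ) * algSol 0 x := by
    simp only [algSol, Matrix.cons_val]; field_simp
  have a1 : W1 x * Y1 x = P3 x ^ (1 / 2 : ℂ) * algSol 1 x := by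
    simp only [algSol, Matrix.cons_val]; field_simp
  have a2 : W2 x * Y2 x = P3 x ^ (1 / 2 : ℂ) * algSol 2 x := by
    simp only [algSol, Matrix.cons_val]; field_simp
  -- The factor √P₃ restored here combines with P₃^(-7/3) and its square: 1/2 - 7/3 = -11/6 and 1/2
  -- - 14/3 = -25/6. Exponents add without branch corrections, as the base is the same.
  have e1 : P3 x ^ (1 / 2 : ℂ) * P3 x ^ (-7 / 3 : ℂ) = P3 x ^ (-11 / 6 : ℂ) :=
    cpow_half_mul_cpow hP (by norm_num)
  have e2 : P3 x ^ (1 / 2 : ℂ) * (P3 x ^ (-7 / 3 : ℂ) * P3 x ^ (-7 / 3 : ℂ)) =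
      P3 x ^ (-25 / 6 : ℂ) := by
    rw [← Complex.cpow_add _ _ hP]
    exact cpow_half_mul_cpow hP (by norm_num)
  have k₁ := I₁ x hx
  have k₂ := I₂ x hx
  have k₃ := I₃ x hx
  simp only [cubeRootFactor] at k₂ k₃
  rw [a0, a1, a2, ← e1, ← e2]
  refine ⟨?_, ?_, ?_⟩
  · linear_combination P3 x ^ (1 / 2 : ℂ) * k₁
  · linear_combination P3 x ^ (1 / 2 : ℂ) * k₂
  · linear_combination P3 x ^ (1 / 2 : ℂ) * k₃

end Darboux3B

theorem mainTheorem4 :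
    -- the three hypergeometric series converge at `Ψ₃(x)` for `x` near `0`
    (∀ᶠ x in 𝓝 (0 : ℂ),
      Summable (fun n : ℕ =>
        Darboux3B.hyp32Coeff (-1 / 14) (3 / 14) (5 / 14) (1 / 3) (2 / 3) n *
          Darboux3B.Psi3 x ^ n) ∧
      Summable (fun n : ℕ =>
        Darboux3B.hyp32Coeff (11 / 42) (23 / 42) (29 / 42) (2 / 3) (4 / 3) n *
          Darboux3B.Psi3 x ^ n) ∧
      Summable (fun n : ℕ =>
        Darboux3B.hyp32Coeff (25 / 42) (37 / 42) (43 / 42) (4 / 3) (5 / 3) n *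
          Darboux3B.Psi3 x ^ n)) ∧
    -- the three identities
    (∀ᶠ x in 𝓝 (0 : ℂ),
      Darboux3B.P3 x ^ (1 / 2 : ℂ) *
          Darboux3B.hyp32 (-1 / 14) (3 / 14) (5 / 14) (1 / 3) (2 / 3) (Darboux3B.Psi3 x) =
        (3 + Darboux3B.s7) / 6 * (Darboux3B.W1 x * Darboux3B.Y1 x) +
          (3 - Darboux3B.s7) / 6 * (Darboux3B.W2 x * Darboux3B.Y2 x)) ∧
    (∀ᶠ x in 𝓝 (0 : ℂ),
      x * Darboux3B.Q3 x * Darboux3B.P3 x ^ (-11 / 6 : ℂ) *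
          Darboux3B.hyp32 (11 / 42) (23 / 42) (29 / 42) (2 / 3) (4 / 3) (Darboux3B.Psi3 x) =
        1 / 2 * (x * Darboux3B.Y0 x) -
          Darboux3B.s7 / 6 * (Darboux3B.W1 x * Darboux3B.Y1 x) +
          Darboux3B.s7 / 6 * (Darboux3B.W2 x * Darboux3B.Y2 x)) ∧
    (∀ᶠ x in 𝓝 (0 : ℂ),
      x ^ 2 * Darboux3B.Q3 x ^ 2 * Darboux3B.P3 x ^ (-25 / 6 : ℂ) *
          Darboux3B.hyp32 (25 / 42) (37 / 42) (43 / 42) (4 / 3) (5 / 3) (Darboux3B.Psi3 x) =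
        6 * (x * Darboux3B.Y0 x) +
          2 * Darboux3B.s7 * (Darboux3B.W1 x * Darboux3B.Y1 x) -
          2 * Darboux3B.s7 * (Darboux3B.W2 x * Darboux3B.Y2 x)) ∧
    -- `x Y₀, W₁ Y₁, W₂ Y₂` is a solution basis of the pulled-back equation near `x = 0`
    Darboux3B.IsPullbackSolutionBasisNearZero (-1 / 14) (3 / 14) (5 / 14) (1 / 3) (2 / 3)
      (fun x => Darboux3B.P3 x ^ (1 / 2 : ℂ)) Darboux3B.Psi3
      ![fun x => x * Darboux3B.Y0 x,
        fun x => Darboux3B.W1 x * Darboux3B.Y1 x,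
        fun x => Darboux3B.W2 x * Darboux3B.Y2 x] := by
  have hΨ : ∀ᶠ x in 𝓝 (0 : ℂ), ‖Darboux3B.Psi3 x‖ < 1 := by
    obtain ⟨r, hr, H⟩ := Darboux3B.exists_ball_isTameAt
    filter_upwards [Metric.ball_mem_nhds 0 hr] with x hx using (H x hx).2.2
  refine ⟨?_, Darboux3B.hypergeometric_identities.mono fun x h => h.1,
    Darboux3B.hypergeometric_identities.mono fun x h => h.2.1,
    Darboux3B.hypergeometric_identities.mono fun x h => h.2.2,
    Darboux3B.isPullbackSolutionBasisNearZero_algebraic⟩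
  filter_upwards [hΨ] with x hx
  refine ⟨Darboux3B.summable_of_poly_bound (C := 1) (k := 0) (fun n => ?_) hx,
    Darboux3B.summable_of_poly_bound (C := 1) (k := 0) (fun n => ?_) hx,
    Darboux3B.summable_of_poly_bound (C := 1) (k := 0) (fun n => ?_) hx⟩
  · simpa using Darboux3B.norm_hyp32Coeff_first n
  · simpa using Darboux3B.norm_hyp32Coeff_second n
  · simpa using Darboux3B.norm_hyp32Coeff_third n
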